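/- Let $c_1,c_2\in\mathbb{R}$ and consider the coupled Sasa–Satsuma–mKdV system $$u_t=u_{xxx}-6c_1|u|^2u_x-3c_1u\,(|u|^2)_x-3c_2v\,(uv)_x,$$ $$v_t=v_{xxx}-6c_1|u|^2v_x-3c_1v\,(|u|^2)_x-6c_2v^2v_x,$$ for a complex-valued function $u(x,t)$ and a real-valued function $v(x,t)$, $x,t\in\mathbb{R}$. Let $N\ge 0$ be an integer, $\rho_1>0$ and $\alpha\in\mathbb{R}$, and let $p_i,\xi_{i,0},D_i$ $(1\le i\le N)$ be complex numbers with $$p_{N+1-i}^*=p_i,\qquad \xi_{N+1-i,0}^*=\xi_{i,0},\qquad D_i^*=D_{N+1-i},$$ where $*$ is complex conjugation. Assume that for all $i,j$ the denominators below do not vanish, i.e. $p_i+p_j^*\neq0$ and $\frac{2c_1\rho_1^2(p_ip_j^*+\alpha^2)}{(p_i^2+\alpha^2)((p_j^*)^2+\alpha^2)}\neq1$ (the first condition gives $p_i^2+\alpha^2\neq0$ and $p_j^*+\mathrm{i}\alpha\ne0$). Put $$\xi_i=p_i(x-6c_1\rho_1^2t)+p_i^3t+\xi_{i,0},\qquad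 c_{i,j}=\frac{c_2D_i^*D_j}{\dfrac{2c_1\rho_1^2(p_ip_j^*+\alpha^2)}{(p_i^2+\alpha^2)((p_j^*)^2+\alpha^2)}-1},$$ $$(M_q)_{ij}=\frac{1}{p_i+p_j^*}\left(\left(-\frac{p_i-\mathrm{i}\alpha}{p_j^*+\mathrm{i}\alpha}\right)^{q}e^{\xi_i+\xi_j^*}+c_{i,j}\right),\qquad q\in\{0,1\},$$ $$\Phi=(e^{\xi_1},\dots,e^{\xi_N})^T,\qquad \Psi=(D_1,\dots,D_N)^T,$$ $$f=\det M_0,\qquad h_1=\det M_1,\qquad g_2=\det\begin{pmatrix}M_0&\Phi\\-\Psi^T&0\end{pmatrix}.$$ Then $g_2/f$ is real-valued, and on the open set of all $(x,t)\in\mathbb{R}^2$ with $f(x,t)\ne0$ the functions $$u=\rho_1\frac{h_1}{f}\,e^{\mathrm{i}(\alpha x-(\alpha^3+6c_1\alpha\rho_1^2)t)},\qquad v=\frac{g_2}{f}$$ are three times continuously differentiable and solve the system. Moreover, if the constant matrix $\bigl(c_{i,j}/(p_i+p_j^*)\bigr)_{i,j=1}^N$ is invertible, the solution is dark–bright: for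 every fixed $t$, as $x\to+\infty$ and as $x\to-\infty$, one has $f(x,t)\neq0$ for all sufficiently large $|x|$, $|u(x,t)|\to\rho_1$ and $v(x,t)\to0$. -/

import Mathlib

open scoped ComplexConjugate Topology

/-- The coupled Sasa-Satsuma-mKdV system, in the classical sense, on an open set `U` of the
`(x, t)`-plane:
`u_t = u_xxx - 6 c₁ |u|² u_x - 3 c₁ u (|u|²)_x - 3 c₂ v (u v)_x`,
`v_t = v_xxx - 6 c₁ |u|² v_x - 3 c₁ v (|u|²)_x - 6 c₂ v² v_x`,
for a complex-valued `u = u x t` and a real-valued `v = v x t`. -/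
def IsSSmKdVSolutionOn (c₁ c₂ : ℝ) (u : ℝ → ℝ → ℂ) (v : ℝ → ℝ → ℝ) (U : Set (ℝ × ℝ)) : Prop :=
  IsOpen U ∧
  ContDiffOn ℝ 3 (fun q : ℝ × ℝ => u q.1 q.2) U ∧
  ContDiffOn ℝ 3 (fun q : ℝ × ℝ => v q.1 q.2) U ∧
  ∀ x t : ℝ, (x, t) ∈ U →
    (deriv (fun s => u x s) t =
      iteratedDeriv 3 (fun y => u y t) x
        - 6 * (c₁ : ℂ) * ((‖u x t‖ ^ 2 : ℝ) : ℂ) * deriv (fun y => u y t) x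
        - 3 * (c₁ : ℂ) * u x t * ((deriv (fun y => ‖u y t‖ ^ 2) x : ℝ) : ℂ)
        - 3 * (c₂ : ℂ) * (v x t : ℂ) * deriv (fun y => u y t * (v y t : ℂ)) x) ∧
    (deriv (fun s => v x s) t =
      iteratedDeriv 3 (fun y => v y t) x
        - 6 * c₁ * ‖u x t‖ ^ 2 * deriv (fun y => v y t) x
        - 3 * c₁ * v x t * deriv (fun y => ‖u y t‖ ^ 2) x
        - 6 * c₂ * v x t ^ 2 * deriv (fun y => v y t) x)

namespace DarkBright

/-- `ξ_i = p_i (x - 6 c₁ ρ₁² t) + p_i³ t + ξ_{i,0}`. -/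
noncomputable def xi {N : ℕ} (c₁ ρ₁ : ℝ) (p ξ₀ : Fin N → ℂ) (x t : ℝ) (i : Fin N) : ℂ :=
  p i * ((x : ℂ) - 6 * c₁ * ρ₁ ^ 2 * t) + p i ^ 3 * t + ξ₀ i

/-- The denominator `2 c₁ ρ₁² (p_i p_j* + α²) / ((p_i² + α²) ((p_j*)² + α²)) - 1` of `c_{i,j}`. -/
noncomputable def coeffDenom {N : ℕ} (c₁ ρ₁ α : ℝ) (p : Fin N → ℂ) (i j : Fin N) : ℂ :=
  2 * c₁ * ρ₁ ^ 2 * (p i * conj (p j) + α ^ 2) /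
    ((p i ^ 2 + α ^ 2) * (conj (p j) ^ 2 + α ^ 2)) - 1

/-- The coefficient `c_{i,j}`. -/
noncomputable def coeff {N : ℕ} (c₁ c₂ ρ₁ α : ℝ) (p D : Fin N → ℂ) (i j : Fin N) : ℂ :=
  c₂ * conj (D i) * D j / coeffDenom c₁ ρ₁ α p i j

/-- The `N × N` matrix `M_q`. -/
noncomputable def M {N : ℕ} (c₁ c₂ ρ₁ α : ℝ) (p ξ₀ D : Fin N → ℂ) (q : ℕ) (x t : ℝ) :
    Matrix (Fin N) (Fin N) ℂ :=
  Matrix.of fun i j =>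
    1 / (p i + conj (p j)) *
      ((-((p i - Complex.I * α) / (conj (p j) + Complex.I * α))) ^ q *
          Complex.exp (xi c₁ ρ₁ p ξ₀ x t i + conj (xi c₁ ρ₁ p ξ₀ x t j))
        + coeff c₁ c₂ ρ₁ α p D i j)

/-- `f = |M₀|`. -/
noncomputable def f {N : ℕ} (c₁ c₂ ρ₁ α : ℝ) (p ξ₀ D : Fin N → ℂ) (x t : ℝ) : ℂ :=
  (M c₁ c₂ ρ₁ α p ξ₀ D 0 x t).det

/-- `h₁ = |M₁|`. -/
noncomputable def h₁ {N : ℕ} (c₁ c₂ ρ₁ α : ℝ) (p ξ₀ D : Fin N → ℂ) (x t : ℝ) : ℂ :=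
  (M c₁ c₂ ρ₁ α p ξ₀ D 1 x t).det

/-- The `(N+1) × (N+1)` bordered determinant `g₂`: the last column is `(e^{ξ_1}, …, e^{ξ_N}, 0)`
and the last row is `(-D_1, …, -D_N, 0)`. -/
noncomputable def g₂ {N : ℕ} (c₁ c₂ ρ₁ α : ℝ) (p ξ₀ D : Fin N → ℂ) (x t : ℝ) : ℂ :=
  (Matrix.fromBlocks
    (M c₁ c₂ ρ₁ α p ξ₀ D 0 x t)
    (Matrix.replicateCol Unit fun i => Complex.exp (xi c₁ ρ₁ p ξ₀ x t i))
    (-Matrix.replicateRow Unit D)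
    0).det

/-- `u = ρ₁ (h₁ / f) exp (i (α x - (α³ + 6 c₁ α ρ₁²) t))`. -/
noncomputable def u {N : ℕ} (c₁ c₂ ρ₁ α : ℝ) (p ξ₀ D : Fin N → ℂ) (x t : ℝ) : ℂ :=
  ρ₁ * (h₁ c₁ c₂ ρ₁ α p ξ₀ D x t / f c₁ c₂ ρ₁ α p ξ₀ D x t) *
    Complex.exp (Complex.I * (α * x - (α ^ 3 + 6 * c₁ * α * ρ₁ ^ 2) * t))

end DarkBright

/-! Write φ = (e^{ξ_i}), ψ = (e^{ξ_i*}), P = diag(p_i). The matrix M = M₀ satisfies the Sylvester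
equation P M + M P* = φ ψᵀ + c, and ∂_x M = φ ψᵀ has rank one. Determinant identities turn u and
g₂/f into amplitudes d₀, where d_k = βᵏ E - aᵀ M⁻¹ Pᵏ φ: for u the background E is the plane wave
and β = iα (`u_eq_darkAmp`), for v both vanish (`g₂_div_f`). Hermitian symmetry of M, combined with
reversal of the indices, shows that v is real and that the conjugate of u is the amplitude with -α
in place of α.

Put s_{jk} = ψᵀ (P*)ʲ M⁻¹ Pᵏ φ. Because ∂_x M has rank one and ∂_t M is a sum of rank-one matrices,
all amplitudes obey the same recursions with coefficients s_{jk}. Hence u, its conjugate and v solve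
one and the same linear third-order equation (`IsAmplitude.evolution`). The nonlinearity enters only
when its coefficients are identified with 2c₁|u|² + c₂v² and c₁(|u|²)_x + c₂ v v_x. That is
`bilinear_zero` and `bilinear_one`, which rest on the Sylvester equation, on its resolvent version
at ±iα, and on the particular denominator of c_{i,j}, which splits into partial fractions at ±iα.

For the limits in x, each e^{ξ_i} grows or decays. Rescaling rows and columns by the growing ones
makes M converge to a block diagonal matrix whose blocks are, up to diagonal factors, Cauchy
matrices. They are nonsingular when the constant matrix is (`det_limitMatrix_ne_zero`). The limit of
h₁/f is a product of unimodular phases and that of g₂/f is 0. -/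

namespace DarkBright
open Matrix Filter

/-! ### Pairings through an inverse matrix: symmetries, Sylvester equations, derivatives. -/

variable {n : Type*} [Fintype n] [DecidableEq n]

/-- The bilinear pairing of two vectors through the inverse of a matrix. -/
noncomputable def pairing (M : Matrix n n ℂ) (a b : n → ℂ) : ℂ :=
  a ⬝ᵥ M⁻¹ *ᵥ b

lemma pairing_add_left (M : Matrix n n ℂ) (a a' b : n → ℂ) :
    pairing M (a + a') b = pairing M a b + pairing M a' b := by
  simp [pairing, add_dotProduct]

lemma pairing_add_right (M : Matrix n n ℂ) (a b b' : n → ℂ) :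
    pairing M a (b + b') = pairing M a b + pairing M a b' := by
  simp [pairing, mulVec_add, dotProduct_add]

lemma pairing_smul_left (M : Matrix n n ℂ) (z : ℂ) (a b : n → ℂ) :
    pairing M (z • a) b = z * pairing M a b := by
  simp [pairing]

lemma pairing_smul_right (M : Matrix n n ℂ) (z : ℂ) (a b : n → ℂ) :
    pairing M a (z • b) = z * pairing M a b := by
  simp [pairing, mulVec_smul]

lemma pairing_transpose (M : Matrix n n ℂ) (a b : n → ℂ) :
    pairing Mᵀ a b = pairing M b a := by
  rw [pairing, pairing, ← transpose_nonsing_inv, mulVec_transpose, dotProduct_comm,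
    ← dotProduct_mulVec]

lemma pairing_conj (M : Matrix n n ℂ) (a b : n → ℂ) :
    conj (pairing M a b) = pairing (M.map conj) (fun i => conj (a i)) (fun i => conj (b i)) := by
  have h : (M.map conj)⁻¹ = (M⁻¹).map conj := by
    have := conjTranspose_nonsing_inv M
    have h2 := congrArg transpose this
    rw [transpose_nonsing_inv] at h2
    exact h2.symm
  simp only [pairing, h, dotProduct, mulVec, map_sum, map_mul, map_apply]

lemma pairing_reindex (M : Matrix n n ℂ) (a b : n → ℂ) (e : n ≃ n) :
    pairing (M.submatrix e e) (a ∘ e) (b ∘ e) = pairing M a b := by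
  rw [pairing, pairing, inv_submatrix_equiv, submatrix_mulVec_equiv]
  simp [Function.comp_assoc]

lemma dotProduct_rank_one {n : Type*} [Fintype n] (X : Matrix n n ℂ) (φ ψ a b : n → ℂ) :
    a ⬝ᵥ X *ᵥ vecMulVec φ ψ *ᵥ b = (a ⬝ᵥ X *ᵥ φ) * (ψ ⬝ᵥ b) := by
  rw [vecMulVec_mulVec]
  simp [mulVec_smul, dotProduct_smul, mul_comm]

/-- A Sylvester equation `P M + M Q = φ ψᵀ + c` with diagonal `P` and `Q`, paired through `M⁻¹`. -/
lemma pairing_sylvester {M : Matrix n n ℂ} (hM : M.det ≠ 0) (p q φ ψ : n → ℂ)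
    (c : Matrix n n ℂ) (h : ∀ i j, (p i + q j) * M i j = φ i * ψ j + c i j) (a b : n → ℂ) :
    pairing M (q * a) b + pairing M a (p * b)
      = pairing M a φ * pairing M ψ b + a ⬝ᵥ M⁻¹ *ᵥ c *ᵥ M⁻¹ *ᵥ b := by
  have hu := isUnit_iff_ne_zero.2 hM
  have h1 : diagonal p * M + M * diagonal q = vecMulVec φ ψ + c := by
    ext i j
    simp only [Matrix.add_apply, diagonal_mul, mul_diagonal, vecMulVec_apply, ← h]
    ring
  -- The Sylvester equation multiplied by M⁻¹ on both sides.
  have h2 : diagonal q * M⁻¹ + M⁻¹ * diagonal p = M⁻¹ * (vecMulVec φ ψ + c) * M⁻¹ := by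
    rw [← h1, Matrix.mul_add, Matrix.add_mul, Matrix.mul_assoc, Matrix.mul_assoc,
      mul_nonsing_inv _ hu, ← Matrix.mul_assoc M⁻¹ M, nonsing_inv_mul _ hu, Matrix.one_mul,
      Matrix.mul_one, add_comm]
  have h3 := congrArg (fun X : Matrix n n ℂ => a ⬝ᵥ X *ᵥ b) h2
  simp only [add_mulVec, dotProduct_add, ← mulVec_mulVec, mulVec_add, dotProduct_rank_one] at h3
  have h4 : diagonal p *ᵥ b = p * b := by ext i; simp [mulVec_diagonal]
  have h5 : a ⬝ᵥ diagonal q *ᵥ M⁻¹ *ᵥ b = (q * a) ⬝ᵥ M⁻¹ *ᵥ b := by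
    rw [dotProduct_mulVec]
    congr 1
    ext i; simp [vecMul_diagonal, mul_comm]
  rw [h4, h5] at h3
  exact h3

/-- Schur complement of the block M. -/
lemma det_bordered {M : Matrix n n ℂ} (hM : M.det ≠ 0) (φ D : n → ℂ) :
    (fromBlocks M (replicateCol Unit φ) (-replicateRow Unit D) 0).det
      = M.det * pairing M D φ := by
  have := invertibleOfIsUnitDet M (isUnit_iff_ne_zero.2 hM)
  rw [det_fromBlocks₁₁]
  congr 1
  rw [det_unique, pairing, dotProduct_mulVec]
  simp [invOf_eq_nonsing_inv, Matrix.mul_apply, dotProduct, vecMul]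

lemma det_sub_rank_one {M : Matrix n n ℂ} (hM : M.det ≠ 0) (φ ψ : n → ℂ) :
    (M - vecMulVec φ ψ).det = M.det * (1 - pairing M ψ φ) := by
  have h := det_add_replicateCol_mul_replicateRow (ι := Unit) (isUnit_iff_ne_zero.2 hM) (-φ) ψ
  have h1 : M + replicateCol Unit (-φ) * replicateRow Unit ψ = M - vecMulVec φ ψ := by
    ext i j; simp [Matrix.mul_apply, vecMulVec_apply, sub_eq_add_neg]
  rw [h1] at h
  rw [h]
  congr 1
  rw [det_unique, pairing, dotProduct_mulVec]
  simp [Matrix.mul_apply, dotProduct, vecMul, sub_eq_add_neg]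

/-- Cramer's rule makes the entries of the inverse differentiable; the value of the derivative then
follows by differentiating M⁻¹ M = 1, valid near x. Working entrywise avoids choosing a norm on
matrices. -/
lemma hasDerivAt_inv {M : ℝ → Matrix n n ℂ} {M' : Matrix n n ℂ} {x : ℝ}
    (h : ∀ i j, HasDerivAt (fun y => M y i j) (M' i j) x) (hM : (M x).det ≠ 0) (i j : n) :
    HasDerivAt (fun y => (M y)⁻¹ i j) ((-((M x)⁻¹ * M' * (M x)⁻¹)) i j) x := by
  have hdet : ∀ (A : ℝ → Matrix n n ℂ), (∀ i j, DifferentiableAt ℝ (fun y => A y i j) x) →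
      DifferentiableAt ℝ (fun y => (A y).det) x := by
    intro A hA
    simp only [det_apply]
    fun_prop
  have hMd : ∀ i j, DifferentiableAt ℝ (fun y => M y i j) x :=
    fun i j => (h i j).differentiableAt
  have hX : ∀ i j, DifferentiableAt ℝ (fun y => (M y)⁻¹ i j) x := by
    intro i j
    have he : (fun y => (M y)⁻¹ i j)
        = fun y => ((M y).det)⁻¹ * ((M y).updateRow j (Pi.single i 1)).det := by
      ext y
      rw [inv_def, Ring.inverse_eq_inv', ← adjugate_apply]
      rfl
    rw [he]
    refine ((hdet M hMd).inv hM).mul (hdet _ fun k l => ?_)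
    by_cases hk : k = j
    · subst hk; simp
    · simp only [updateRow_ne hk]; exact hMd k l
  set X' : Matrix n n ℂ := of fun i j => deriv (fun y => (M y)⁻¹ i j) x with hX'
  have hev : ∀ᶠ y in 𝓝 x, (M y).det ≠ 0 := (hdet M hMd).continuousAt.eventually_ne hM
  have key : X' * M x + (M x)⁻¹ * M' = 0 := by
    ext i j
    have h1 : HasDerivAt (fun y => ∑ k, (M y)⁻¹ i k * M y k j)
        (∑ k, (X' i k * M x k j + (M x)⁻¹ i k * M' k j)) x :=
      HasDerivAt.fun_sum fun k _ => (hX i k).hasDerivAt.mul (h k j)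
    have h2 : (fun y => ∑ k, (M y)⁻¹ i k * M y k j) =ᶠ[𝓝 x] fun _ => (1 : Matrix n n ℂ) i j := by
      filter_upwards [hev] with y hy
      rw [← nonsing_inv_mul (M y) (isUnit_iff_ne_zero.2 hy), Matrix.mul_apply]
    have h3 := (h1.congr_of_eventuallyEq h2.symm).unique (hasDerivAt_const x _)
    simpa [Matrix.add_apply, Matrix.mul_apply, Finset.sum_add_distrib] using h3
  have key2 : X' = -((M x)⁻¹ * M' * (M x)⁻¹) := by
    have := congrArg (· * (M x)⁻¹) (eq_neg_of_add_eq_zero_left key)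
    simpa [Matrix.mul_assoc, mul_nonsing_inv _ (isUnit_iff_ne_zero.2 hM)] using this
  rw [← key2]
  exact (hX i j).hasDerivAt

lemma hasDerivAt_pairing {M : ℝ → Matrix n n ℂ} {M' : Matrix n n ℂ} {a b : ℝ → n → ℂ}
    {a' b' : n → ℂ} {x : ℝ}
    (ha : ∀ i, HasDerivAt (fun y => a y i) (a' i) x)
    (hb : ∀ i, HasDerivAt (fun y => b y i) (b' i) x)
    (h : ∀ i j, HasDerivAt (fun y => M y i j) (M' i j) x) (hM : (M x).det ≠ 0) :
    HasDerivAt (fun y => pairing (M y) (a y) (b y))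
      (pairing (M x) a' (b x) + pairing (M x) (a x) b'
        - a x ⬝ᵥ (M x)⁻¹ *ᵥ M' *ᵥ (M x)⁻¹ *ᵥ b x) x := by
  have h1 : HasDerivAt (fun y => ∑ i, a y i * ∑ j, (M y)⁻¹ i j * b y j)
      (∑ i, (a' i * ∑ j, (M x)⁻¹ i j * b x j + a x i *
        ∑ j, ((-((M x)⁻¹ * M' * (M x)⁻¹)) i j * b x j + (M x)⁻¹ i j * b' j))) x :=
    HasDerivAt.fun_sum fun i _ => (ha i).mul <|
      HasDerivAt.fun_sum fun j _ => (hasDerivAt_inv h hM i j).mul (hb j)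
  convert! h1 using 1
  have : a x ⬝ᵥ (M x)⁻¹ *ᵥ M' *ᵥ (M x)⁻¹ *ᵥ b x
      = a x ⬝ᵥ ((M x)⁻¹ * M' * (M x)⁻¹) *ᵥ b x := by
    simp [mulVec_mulVec, Matrix.mul_assoc]
  rw [this]
  simp only [pairing, dotProduct, mulVec, Matrix.neg_apply, Finset.sum_add_distrib, mul_add, neg_mul,
    Finset.sum_neg_distrib, mul_neg]
  ring

end DarkBright

/-! ### Moments, dressed amplitudes and their recursions. -/

namespace DarkBright
open Matrix Filter

variable {n : Type*} [Fintype n] [DecidableEq n]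

/-- The moments `ψᵀ Qʲ M⁻¹ Pᵏ φ`, with `P` and `Q` diagonal. -/
noncomputable def moment (p q φ ψ : n → ℂ) (M : Matrix n n ℂ) (j k : ℕ) : ℂ :=
  pairing M (q ^ j * ψ) (p ^ k * φ)

/-- The dressed amplitudes `βᵏ E - aᵀ M⁻¹ Pᵏ φ`. For `k = 0` these are the components of the
solution; `E` is the background and `β` its wave number. -/
noncomputable def dressed (p φ : n → ℂ) (M : Matrix n n ℂ) (a : n → ℂ) (β E : ℂ) (k : ℕ) : ℂ :=
  β ^ k * E - pairing M a (p ^ k * φ)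

section space

variable {p q : n → ℂ} {φ ψ a : ℝ → n → ℂ} {M : ℝ → Matrix n n ℂ} {E : ℝ → ℂ} {β : ℂ} {x : ℝ}

/-- The derivative of M is the rank-one matrix φ ψᵀ, so the term coming from M⁻¹ factors into a
product of two moments. -/
lemma hasDerivAt_moment
    (hφ : ∀ i, HasDerivAt (fun y => φ y i) (p i * φ x i) x)
    (hψ : ∀ i, HasDerivAt (fun y => ψ y i) (q i * ψ x i) x)
    (hM : ∀ i j, HasDerivAt (fun y => M y i j) (φ x i * ψ x j) x)
    (hdet : (M x).det ≠ 0) (j k : ℕ) :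
    HasDerivAt (fun y => moment p q (φ y) (ψ y) (M y) j k)
      (moment p q (φ x) (ψ x) (M x) (j + 1) k + moment p q (φ x) (ψ x) (M x) j (k + 1)
        - moment p q (φ x) (ψ x) (M x) j 0 * moment p q (φ x) (ψ x) (M x) 0 k) x := by
  have h := hasDerivAt_pairing (M' := vecMulVec (φ x) (ψ x)) (a := fun y => q ^ j * ψ y)
    (b := fun y => p ^ k * φ y) (a' := q ^ (j + 1) * ψ x) (b' := p ^ (k + 1) * φ x)
    (fun i => ((hψ i).const_mul (q i ^ j)).congr_deriv (by simp [pow_succ, mul_assoc]))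
    (fun i => ((hφ i).const_mul (p i ^ k)).congr_deriv (by simp [pow_succ, mul_assoc]))
    hM hdet
  refine h.congr_deriv ?_
  rw [dotProduct_rank_one]
  simp [moment, pairing]

lemma hasDerivAt_dressed
    (hφ : ∀ i, HasDerivAt (fun y => φ y i) (p i * φ x i) x)
    (hM : ∀ i j, HasDerivAt (fun y => M y i j) (φ x i * ψ x j) x)
    (ha : ∀ i, HasDerivAt (fun y => a y i) (E x * ψ x i) x)
    (hE : HasDerivAt E (β * E x) x)
    (hdet : (M x).det ≠ 0) (k : ℕ) :
    HasDerivAt (fun y => dressed p (φ y) (M y) (a y) β (E y) k)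
      (dressed p (φ x) (M x) (a x) β (E x) (k + 1)
        - moment p q (φ x) (ψ x) (M x) 0 k * dressed p (φ x) (M x) (a x) β (E x) 0) x := by
  have h := hasDerivAt_pairing (M' := vecMulVec (φ x) (ψ x)) (a := a)
    (b := fun y => p ^ k * φ y) (a' := E x • ψ x) (b' := p ^ (k + 1) * φ x)
    ha
    (fun i => ((hφ i).const_mul (p i ^ k)).congr_deriv (by simp [pow_succ, mul_assoc]))
    hM hdet
  refine ((hE.const_mul (β ^ k)).sub h).congr_deriv ?_
  rw [dotProduct_rank_one, pairing_smul_left]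
  simp only [moment, dressed, pairing, pow_zero, one_mul]
  ring

end space

section time

variable {p q : n → ℂ} {φ ψ a : ℝ → n → ℂ} {M : ℝ → Matrix n n ℂ} {E : ℝ → ℂ} {β κ : ℂ} {t : ℝ}

/-- The factor p² - pq + q² - 3κ is (p³ + q³)/(p + q) - 3κ. It makes the derivative of M a sum of
four rank-one matrices, so every term of the result is a product of moments and amplitudes. -/
lemma hasDerivAt_dressed_time
    (hφ : ∀ i, HasDerivAt (fun y => φ y i) ((p i ^ 3 - 3 * κ * p i) * φ t i) t)
    (hM : ∀ i j, HasDerivAt (fun y => M y i j)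
      ((p i ^ 2 - p i * q j + q j ^ 2 - 3 * κ) * (φ t i * ψ t j)) t)
    (ha : ∀ i, HasDerivAt (fun y => a y i)
      ((β ^ 2 - β * q i + q i ^ 2 - 3 * κ) * (E t * ψ t i)) t)
    (hE : HasDerivAt E ((β ^ 3 - 3 * κ * β) * E t) t)
    (hdet : (M t).det ≠ 0) {s : ℕ → ℕ → ℂ} {d : ℕ → ℂ}
    (hs : s = moment p q (φ t) (ψ t) (M t)) (hd : d = dressed p (φ t) (M t) (a t) β (E t)) :
    HasDerivAt (fun y => dressed p (φ y) (M y) (a y) β (E y) 0)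
      (d 3 - 3 * κ * d 1 - s 0 0 * d 2 + s 1 0 * d 1 - s 2 0 * d 0 + 3 * κ * s 0 0 * d 0) t := by
  have h := hasDerivAt_pairing (a := a) (b := φ)
    (M' := vecMulVec (p ^ 2 * φ t) (ψ t) + (-1 : ℂ) • vecMulVec (p * φ t) (q * ψ t)
      + vecMulVec (φ t) (q ^ 2 * ψ t) + (-(3 * κ)) • vecMulVec (φ t) (ψ t))
    (a' := (E t * (β ^ 2 - 3 * κ)) • ψ t + (-(E t * β)) • (q * ψ t) + E t • (q ^ 2 * ψ t))
    (b' := p ^ 3 * φ t + (-(3 * κ)) • (p * φ t))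
    (fun i => (ha i).congr_deriv (by simp; ring))
    (fun i => (hφ i).congr_deriv (by simp; ring))
    (fun i j => (hM i j).congr_deriv (by simp [vecMulVec_apply]; ring)) hdet
  have h2 := (hE.sub h)
  have e : (fun y => dressed p (φ y) (M y) (a y) β (E y) 0)
      = E - fun y => pairing (M y) (a y) (φ y) := by
    ext y; simp [dressed]
  rw [e]
  refine h2.congr_deriv ?_
  subst hs hd
  simp only [add_mulVec, smul_mulVec, mulVec_add, mulVec_smul, dotProduct_add, dotProduct_smul,
    dotProduct_rank_one, pairing_add_left, pairing_add_right, pairing_smul_left,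
    pairing_smul_right, smul_eq_mul]
  simp only [moment, dressed, pairing, pow_zero, one_mul, pow_one]
  ring

end time

/-- The third derivative of the first member of a family obeying the dressing recursion. -/
lemma iteratedDeriv_three_of_recursion {d : ℕ → ℝ → ℂ} {s : ℕ → ℕ → ℝ → ℂ} {x : ℝ}
    (hd : ∀ᶠ y in 𝓝 x, ∀ k, HasDerivAt (d k) (d (k + 1) y - s 0 k y * d 0 y) y)
    (hs : ∀ᶠ y in 𝓝 x, ∀ j k,
      HasDerivAt (s j k) (s (j + 1) k y + s j (k + 1) y - s j 0 y * s 0 k y) y) :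
    iteratedDeriv 3 (d 0) x =
      d 3 x - s 0 0 x * d 2 x
        - (2 * (s 1 0 x + s 0 1 x - s 0 0 x ^ 2) + s 0 1 x - s 0 0 x ^ 2) * d 1 x
        + (- s 0 2 x - (s 2 0 x + 3 * s 1 1 x + 2 * s 0 2 x
            - 2 * s 0 1 x * s 0 0 x - s 1 0 x * s 0 0 x
            - 4 * s 0 0 x * (s 1 0 x + s 0 1 x - s 0 0 x ^ 2))
          + s 0 0 x * s 0 1 x
          + s 0 0 x * (s 1 0 x + 2 * s 0 1 x - 2 * s 0 0 x ^ 2)) * d 0 x := by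
  have h1 : deriv (d 0) =ᶠ[𝓝 x] fun y => d 1 y - s 0 0 y * d 0 y := by
    filter_upwards [hd] with y hy
    exact (hy 0).deriv
  have h2 : deriv (deriv (d 0)) =ᶠ[𝓝 x] fun y => d 2 y - s 0 0 y * d 1 y
      - (2 * s 0 1 y + s 1 0 y - 2 * s 0 0 y ^ 2) * d 0 y := by
    filter_upwards [hd, hs, h1.eventuallyEq_nhds] with y hy hy' hy1
    rw [hy1.deriv_eq]
    refine (((hy 1).sub ((hy' 0 0).mul (hy 0))).congr_deriv ?_).deriv
    simp only [zero_add]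
    ring
  rw [iteratedDeriv_succ, iteratedDeriv_succ, iteratedDeriv_one, h2.deriv_eq]
  have hy := hd.self_of_nhds
  have hy' := hs.self_of_nhds
  refine ((((hy 2).sub ((hy' 0 0).mul (hy 1))).sub
    ((((hy' 0 1).const_mul 2).add (hy' 1 0)).sub (((hy' 0 0).pow 2).const_mul 2) |>.mul
      (hy 0))).congr_deriv ?_).deriv
  simp only [zero_add]
  norm_num
  ring

end DarkBright

/-! ### The amplitudes of the solution and their symmetries. -/

namespace DarkBright
open Matrix Filter

/-- The exponentials `e^{ξ_i}`. -/
noncomputable def expXi {N : ℕ} (c₁ ρ₁ : ℝ) (p ξ₀ : Fin N → ℂ) (x t : ℝ) (i : Fin N) : ℂ :=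
  Complex.exp (xi c₁ ρ₁ p ξ₀ x t i)

/-- The exponentials `e^{ξ_i*}`. -/
noncomputable def expXiConj {N : ℕ} (c₁ ρ₁ : ℝ) (p ξ₀ : Fin N → ℂ) (x t : ℝ) (i : Fin N) : ℂ :=
  Complex.exp (conj (xi c₁ ρ₁ p ξ₀ x t i))

/-- The plane wave of amplitude `ρ₁` and wave number `a`. -/
noncomputable def planeWave (c₁ ρ₁ a x t : ℝ) : ℂ :=
  ρ₁ * Complex.exp (Complex.I * (a * x - (a ^ 3 + 6 * c₁ * a * ρ₁ ^ 2) * t))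

/-- The components of the solution with background `planeWave c₁ ρ₁ a` (`k = 0`), and their
higher analogues. -/
noncomputable def darkAmp {N : ℕ} (c₁ c₂ ρ₁ α : ℝ) (p ξ₀ D : Fin N → ℂ) (a : ℝ) (k : ℕ)
    (x t : ℝ) : ℂ :=
  dressed p (expXi c₁ ρ₁ p ξ₀ x t) (M c₁ c₂ ρ₁ α p ξ₀ D 0 x t)
    (fun j => planeWave c₁ ρ₁ a x t * expXiConj c₁ ρ₁ p ξ₀ x t j / (conj (p j) + Complex.I * a))
    (Complex.I * a) (planeWave c₁ ρ₁ a x t) k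

/-- The component of the solution with zero background (`k = 0`), and its higher analogues. -/
noncomputable def brightAmp {N : ℕ} (c₁ c₂ ρ₁ α : ℝ) (p ξ₀ D : Fin N → ℂ) (k : ℕ)
    (x t : ℝ) : ℂ :=
  dressed p (expXi c₁ ρ₁ p ξ₀ x t) (M c₁ c₂ ρ₁ α p ξ₀ D 0 x t) (-D) 0 0 k

/-- The moments of the matrix `M₀`. -/
noncomputable def solMoment {N : ℕ} (c₁ c₂ ρ₁ α : ℝ) (p ξ₀ D : Fin N → ℂ) (j k : ℕ)
    (x t : ℝ) : ℂ :=
  moment p (fun i => conj (p i)) (expXi c₁ ρ₁ p ξ₀ x t) (expXiConj c₁ ρ₁ p ξ₀ x t)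
    (M c₁ c₂ ρ₁ α p ξ₀ D 0 x t) j k

variable {N : ℕ} {c₁ c₂ ρ₁ α : ℝ} {p ξ₀ D : Fin N → ℂ} {x t : ℝ}

lemma conj_expXi (i : Fin N) :
    conj (expXi c₁ ρ₁ p ξ₀ x t i) = expXiConj c₁ ρ₁ p ξ₀ x t i := by
  rw [expXi, expXiConj, Complex.exp_conj]

lemma conj_expXiConj (i : Fin N) :
    conj (expXiConj c₁ ρ₁ p ξ₀ x t i) = expXi c₁ ρ₁ p ξ₀ x t i := by
  rw [← conj_expXi, Complex.conj_conj]

lemma conj_planeWave (a : ℝ) :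
    conj (planeWave c₁ ρ₁ a x t) = planeWave c₁ ρ₁ (-a) x t := by
  simp only [planeWave, map_mul, ← Complex.exp_conj, Complex.conj_ofReal]
  congr 2
  simp [map_ofNat]
  ring

lemma planeWave_mul_conj (a : ℝ) :
    conj (planeWave c₁ ρ₁ a x t) * planeWave c₁ ρ₁ a x t = (ρ₁ : ℂ) ^ 2 := by
  rw [conj_planeWave]
  simp only [planeWave]
  rw [mul_mul_mul_comm, ← Complex.exp_add]
  simp only [Complex.ofReal_neg]
  ring_nf
  simp

/-- A zero would make p_j purely imaginary, hence p_j + p_j* = 0. -/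
lemma conj_add_ne (hpp : ∀ i j, p i + conj (p j) ≠ 0) (a : ℝ) (j : Fin N) :
    conj (p j) + Complex.I * a ≠ 0 := by
  intro h
  apply hpp j j
  have h1 : conj (p j) = -(Complex.I * a) := eq_neg_of_add_eq_zero_left h
  have h2 : p j = Complex.I * a := by
    have := congrArg conj h1
    simpa using this
  rw [h1, h2]; ring

lemma sub_ne (hpp : ∀ i j, p i + conj (p j) ≠ 0) (a : ℝ) (j : Fin N) :
    p j - Complex.I * a ≠ 0 := by
  intro h
  apply conj_add_ne hpp a j
  simpa using congrArg conj h

lemma M_zero_apply (i j : Fin N) :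
    M c₁ c₂ ρ₁ α p ξ₀ D 0 x t i j = (expXi c₁ ρ₁ p ξ₀ x t i * expXiConj c₁ ρ₁ p ξ₀ x t j
      + coeff c₁ c₂ ρ₁ α p D i j) / (p i + conj (p j)) := by
  simp only [M, of_apply, pow_zero, one_mul, Complex.exp_add, expXi, expXiConj]
  ring

lemma M_sylvester (hpp : ∀ i j, p i + conj (p j) ≠ 0) (i j : Fin N) :
    (p i + conj (p j)) * M c₁ c₂ ρ₁ α p ξ₀ D 0 x t i j =
      expXi c₁ ρ₁ p ξ₀ x t i * expXiConj c₁ ρ₁ p ξ₀ x t j + coeff c₁ c₂ ρ₁ α p D i j := by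
  rw [M_zero_apply, mul_div_cancel₀ _ (hpp i j)]

/-- The relation 1 + (p_i - iα)/(p_j* + iα) = (p_i + p_j*)/(p_j* + iα) cancels the denominator p_i +
p_j*, which leaves a rank-one difference. -/
lemma M_one_eq (hpp : ∀ i j, p i + conj (p j) ≠ 0) :
    M c₁ c₂ ρ₁ α p ξ₀ D 1 x t = M c₁ c₂ ρ₁ α p ξ₀ D 0 x t
      - vecMulVec (expXi c₁ ρ₁ p ξ₀ x t)
        (fun j => expXiConj c₁ ρ₁ p ξ₀ x t j / (conj (p j) + Complex.I * α)) := by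
  ext i j
  have h1 := hpp i j
  have h2 := conj_add_ne hpp α j
  rw [Matrix.sub_apply, vecMulVec_apply, M_zero_apply]
  simp only [M, of_apply, pow_one, Complex.exp_add, expXi, expXiConj]
  field_simp
  ring

lemma coeffDenom_conj (i j : Fin N) :
    conj (coeffDenom c₁ ρ₁ α p i j) = coeffDenom c₁ ρ₁ α p j i := by
  simp [coeffDenom, mul_comm, map_ofNat]

lemma coeff_conj (i j : Fin N) :
    conj (coeff c₁ c₂ ρ₁ α p D i j) = coeff c₁ c₂ ρ₁ α p D j i := by
  simp only [coeff, map_div₀, map_mul, coeffDenom_conj, Complex.conj_ofReal, Complex.conj_conj]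
  ring

lemma M_map_conj :
    (M c₁ c₂ ρ₁ α p ξ₀ D 0 x t).map conj = (M c₁ c₂ ρ₁ α p ξ₀ D 0 x t)ᵀ := by
  ext i j
  simp only [map_apply, transpose_apply, M_zero_apply, map_div₀, map_add, map_mul, conj_expXi,
    conj_expXiConj, coeff_conj, Complex.conj_conj]
  rw [add_comm (p j), mul_comm (expXi _ _ _ _ _ _ _)]

lemma conj_xi (hp : ∀ i, conj (p i.rev) = p i) (hξ : ∀ i, conj (ξ₀ i.rev) = ξ₀ i) (i : Fin N) :
    conj (xi c₁ ρ₁ p ξ₀ x t i) = xi c₁ ρ₁ p ξ₀ x t i.rev := by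
  have h1 := hp i.rev
  have h2 := hξ i.rev
  rw [Fin.rev_rev] at h1 h2
  simp [xi, ← h1, ← h2, map_ofNat]

lemma expXiConj_eq (hp : ∀ i, conj (p i.rev) = p i) (hξ : ∀ i, conj (ξ₀ i.rev) = ξ₀ i)
    (i : Fin N) : expXiConj c₁ ρ₁ p ξ₀ x t i = expXi c₁ ρ₁ p ξ₀ x t i.rev := by
  rw [expXi, expXiConj, conj_xi hp hξ]

lemma coeff_rev (hp : ∀ i, conj (p i.rev) = p i) (hD : ∀ i, conj (D i) = D i.rev)
    (i j : Fin N) :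
    coeff c₁ c₂ ρ₁ α p D i.rev j.rev = coeff c₁ c₂ ρ₁ α p D j i := by
  have h1 := hp i.rev
  have h2 := hp j.rev
  rw [Fin.rev_rev] at h1 h2
  simp only [coeff, coeffDenom, ← h1, ← h2, ← hD, Complex.conj_conj]
  rw [mul_comm (conj (p i)), mul_comm (conj (p i) ^ 2 + _)]
  ring

/-- Reversal sends p to p*, e^{ξ} to e^{ξ*} and D to D*, so it exchanges the roles of rows and
columns. -/
lemma M_submatrix_rev (hp : ∀ i, conj (p i.rev) = p i) (hξ : ∀ i, conj (ξ₀ i.rev) = ξ₀ i)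
    (hD : ∀ i, conj (D i) = D i.rev) :
    (M c₁ c₂ ρ₁ α p ξ₀ D 0 x t).submatrix Fin.revPerm Fin.revPerm
      = (M c₁ c₂ ρ₁ α p ξ₀ D 0 x t)ᵀ := by
  ext i j
  have h1 := hp i.rev
  have h2 := hp j.rev
  rw [Fin.rev_rev] at h1 h2
  simp only [submatrix_apply, transpose_apply, M_zero_apply, Fin.revPerm_apply, coeff_rev hp hD,
    expXiConj_eq hp hξ, Fin.rev_rev, ← h1, ← h2, Complex.conj_conj]
  rw [add_comm (p j), mul_comm (expXi _ _ _ _ _ _ _)]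

/-- Reversal of the index set and transposition together leave the pairing through `M₀` fixed. -/
lemma pairing_rev (hp : ∀ i, conj (p i.rev) = p i) (hξ : ∀ i, conj (ξ₀ i.rev) = ξ₀ i)
    (hD : ∀ i, conj (D i) = D i.rev) (a b : Fin N → ℂ) :
    pairing (M c₁ c₂ ρ₁ α p ξ₀ D 0 x t) (b ∘ Fin.rev) (a ∘ Fin.rev)
      = pairing (M c₁ c₂ ρ₁ α p ξ₀ D 0 x t) a b := by
  rw [← pairing_reindex _ a b Fin.revPerm, M_submatrix_rev hp hξ hD, pairing_transpose]
  rfl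

/-- Complex conjugation exchanges the arguments of the pairing through `M₀`. -/
lemma conj_pairing_M (a b : Fin N → ℂ) :
    conj (pairing (M c₁ c₂ ρ₁ α p ξ₀ D 0 x t) a b)
      = pairing (M c₁ c₂ ρ₁ α p ξ₀ D 0 x t) (fun i => conj (b i)) (fun i => conj (a i)) := by
  rw [pairing_conj, M_map_conj, pairing_transpose]

lemma darkAmp_zero (a : ℝ) :
    darkAmp c₁ c₂ ρ₁ α p ξ₀ D a 0 x t = planeWave c₁ ρ₁ a x t * (1 -
      pairing (M c₁ c₂ ρ₁ α p ξ₀ D 0 x t)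
        (fun j => expXiConj c₁ ρ₁ p ξ₀ x t j / (conj (p j) + Complex.I * a))
        (expXi c₁ ρ₁ p ξ₀ x t)) := by
  rw [mul_sub, ← pairing_smul_left, darkAmp, dressed]
  simp only [pow_zero, one_mul, mul_one]
  congr 2
  ext j; simp [mul_div_assoc]

lemma darkAmp_eq (a : ℝ) (k : ℕ) :
    darkAmp c₁ c₂ ρ₁ α p ξ₀ D a k x t = planeWave c₁ ρ₁ a x t * ((Complex.I * a) ^ k -
      pairing (M c₁ c₂ ρ₁ α p ξ₀ D 0 x t)
        (fun j => expXiConj c₁ ρ₁ p ξ₀ x t j / (conj (p j) + Complex.I * a))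
        (p ^ k * expXi c₁ ρ₁ p ξ₀ x t)) := by
  rw [mul_sub, ← pairing_smul_left, darkAmp, dressed, mul_comm]
  congr 2
  ext j; simp [mul_div_assoc]

lemma conj_darkAmp_zero (a : ℝ) :
    conj (darkAmp c₁ c₂ ρ₁ α p ξ₀ D a 0 x t) = conj (planeWave c₁ ρ₁ a x t) * (1 -
      pairing (M c₁ c₂ ρ₁ α p ξ₀ D 0 x t) (expXiConj c₁ ρ₁ p ξ₀ x t)
        (fun j => expXi c₁ ρ₁ p ξ₀ x t j / (p j - Complex.I * a))) := by
  rw [darkAmp_zero, map_mul, map_sub, map_one, conj_pairing_M]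
  simp only [map_div₀, conj_expXi, conj_expXiConj, map_add, map_mul, Complex.conj_conj,
    Complex.conj_I, Complex.conj_ofReal, neg_mul, ← sub_eq_add_neg]

/-- Conjugation exchanges the two arguments of the pairing and reversal exchanges them back. The
resolvent 1/(p_j - ia) has then become 1/(p_j* - ia), the one that belongs to -a. -/
lemma conj_darkAmp_zero_eq_neg (hp : ∀ i, conj (p i.rev) = p i)
    (hξ : ∀ i, conj (ξ₀ i.rev) = ξ₀ i) (hD : ∀ i, conj (D i) = D i.rev) (a : ℝ) :
    conj (darkAmp c₁ c₂ ρ₁ α p ξ₀ D a 0 x t) = darkAmp c₁ c₂ ρ₁ α p ξ₀ D (-a) 0 x t := by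
  rw [conj_darkAmp_zero, darkAmp_zero, conj_planeWave, ← pairing_rev hp hξ hD]
  congr 3
  · ext j
    have h1 := hp j
    simp only [Function.comp_apply, expXiConj_eq hp hξ]
    rw [← h1, Complex.conj_conj, ]
    simp [sub_eq_add_neg]
  · ext j
    simp [expXiConj_eq hp hξ]

lemma brightAmp_eq (k : ℕ) :
    brightAmp c₁ c₂ ρ₁ α p ξ₀ D k x t =
      pairing (M c₁ c₂ ρ₁ α p ξ₀ D 0 x t) D (p ^ k * expXi c₁ ρ₁ p ξ₀ x t) := by
  simp [brightAmp, dressed, pairing]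

lemma conj_brightAmp_zero :
    conj (brightAmp c₁ c₂ ρ₁ α p ξ₀ D 0 x t) =
      pairing (M c₁ c₂ ρ₁ α p ξ₀ D 0 x t) (expXiConj c₁ ρ₁ p ξ₀ x t) (fun j => conj (D j)) := by
  rw [brightAmp_eq, conj_pairing_M]
  simp [conj_expXi]

lemma conj_brightAmp_zero_eq_self (hp : ∀ i, conj (p i.rev) = p i)
    (hξ : ∀ i, conj (ξ₀ i.rev) = ξ₀ i) (hD : ∀ i, conj (D i) = D i.rev) :
    conj (brightAmp c₁ c₂ ρ₁ α p ξ₀ D 0 x t) = brightAmp c₁ c₂ ρ₁ α p ξ₀ D 0 x t := by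
  rw [conj_brightAmp_zero, brightAmp_eq, ← pairing_rev hp hξ hD]
  congr 1
  · ext j; simp [hD]
  · ext j; simp [expXiConj_eq hp hξ]

lemma u_eq_darkAmp (hpp : ∀ i j, p i + conj (p j) ≠ 0) (hf : f c₁ c₂ ρ₁ α p ξ₀ D x t ≠ 0) :
    u c₁ c₂ ρ₁ α p ξ₀ D x t = darkAmp c₁ c₂ ρ₁ α p ξ₀ D α 0 x t := by
  rw [darkAmp_zero, u, h₁, M_one_eq hpp, det_sub_rank_one hf, ← f, mul_div_cancel_left₀ _ hf,
    planeWave]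
  ring

lemma g₂_div_f (hf : f c₁ c₂ ρ₁ α p ξ₀ D x t ≠ 0) :
    g₂ c₁ c₂ ρ₁ α p ξ₀ D x t / f c₁ c₂ ρ₁ α p ξ₀ D x t
      = brightAmp c₁ c₂ ρ₁ α p ξ₀ D 0 x t := by
  have h : g₂ c₁ c₂ ρ₁ α p ξ₀ D x t = f c₁ c₂ ρ₁ α p ξ₀ D x t
      * pairing (M c₁ c₂ ρ₁ α p ξ₀ D 0 x t) D (expXi c₁ ρ₁ p ξ₀ x t) := det_bordered hf _ _
  rw [h, mul_div_cancel_left₀ _ hf, brightAmp_eq, pow_zero, one_mul]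

/-! ### Quadratic identities between amplitudes and moments. -/

/-- The quadratic form `ψᵀ M₀⁻¹ (A c B) M₀⁻¹ b` with the resolvents `A = (P - i a)⁻¹` and
`B = (P* + i a)⁻¹`. -/
noncomputable def resolventForm {N : ℕ} (c₁ c₂ ρ₁ α : ℝ) (p ξ₀ D : Fin N → ℂ) (a : ℝ) (x t : ℝ)
    (b : Fin N → ℂ) : ℂ :=
  expXiConj c₁ ρ₁ p ξ₀ x t ⬝ᵥ (M c₁ c₂ ρ₁ α p ξ₀ D 0 x t)⁻¹ *ᵥ
    (of fun i j => coeff c₁ c₂ ρ₁ α p D i j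
      / ((p i - Complex.I * a) * (conj (p j) + Complex.I * a))) *ᵥ
    (M c₁ c₂ ρ₁ α p ξ₀ D 0 x t)⁻¹ *ᵥ b

/-- Since 1/(p_i - ia) + 1/(p_j* + ia) = (p_i + p_j*)/((p_i - ia)(p_j* + ia)), the same matrix
satisfies a second Sylvester equation, with the resolvents in place of P and P*. -/
lemma sylvester_resolvent (hpp : ∀ i j, p i + conj (p j) ≠ 0)
    (hf : f c₁ c₂ ρ₁ α p ξ₀ D x t ≠ 0) (a : ℝ) (b : Fin N → ℂ)
    {m : Matrix (Fin N) (Fin N) ℂ} (hm : m = M c₁ c₂ ρ₁ α p ξ₀ D 0 x t)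
    {φ ψ : Fin N → ℂ} (hφ : φ = expXi c₁ ρ₁ p ξ₀ x t) (hψ : ψ = expXiConj c₁ ρ₁ p ξ₀ x t) :
    pairing m (fun j => ψ j / (conj (p j) + Complex.I * a)) b
      + pairing m ψ (fun j => b j / (p j - Complex.I * a))
      = pairing m ψ (fun j => φ j / (p j - Complex.I * a))
        * pairing m (fun j => ψ j / (conj (p j) + Complex.I * a)) b
      + ψ ⬝ᵥ m⁻¹ *ᵥ (of fun i j => coeff c₁ c₂ ρ₁ α p D i j
          / ((p i - Complex.I * a) * (conj (p j) + Complex.I * a))) *ᵥ m⁻¹ *ᵥ b := by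
  have hdet : m.det ≠ 0 := by rw [hm]; exact hf
  have := pairing_sylvester hdet (fun j => 1 / (p j - Complex.I * a))
    (fun j => 1 / (conj (p j) + Complex.I * a)) (fun j => φ j / (p j - Complex.I * a))
    (fun j => ψ j / (conj (p j) + Complex.I * a))
    (of fun i j => coeff c₁ c₂ ρ₁ α p D i j
          / ((p i - Complex.I * a) * (conj (p j) + Complex.I * a)))
    (by
      intro i j
      have h1 := sub_ne hpp a i
      have h2 := conj_add_ne hpp a j
      have h3 := M_sylvester (c₁ := c₁) (c₂ := c₂) (ρ₁ := ρ₁) (α := α) (ξ₀ := ξ₀) (D := D)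
        (x := x) (t := t) hpp i j
      rw [← hm, ← hφ, ← hψ] at h3
      rw [of_apply]
      field_simp
      linear_combination h3) ψ b
  convert this using 3
  · ext j; simp [div_eq_inv_mul]
  · ext j; simp [div_eq_inv_mul]

/-- This is the one place where the form of c_{i,j} matters: its denominator is the sum of the
partial fractions at iα and -iα, minus 1. -/
lemma coeff_reduction (hpp : ∀ i j, p i + conj (p j) ≠ 0)
    (hc : ∀ i j, coeffDenom c₁ ρ₁ α p i j ≠ 0) (i j : Fin N) :
    (c₂ : ℂ) * (conj (D i) * D j) =
      c₁ * ρ₁ ^ 2 * (coeff c₁ c₂ ρ₁ α p D i j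
          / ((p i - Complex.I * α) * (conj (p j) + Complex.I * α)))
      + c₁ * ρ₁ ^ 2 * (coeff c₁ c₂ ρ₁ α p D i j
          / ((p i - Complex.I * (-α : ℝ)) * (conj (p j) + Complex.I * (-α : ℝ))))
      - coeff c₁ c₂ ρ₁ α p D i j := by
  have h1 := sub_ne hpp α i
  have h2 := conj_add_ne hpp α j
  have h3 := sub_ne hpp (-α) i
  have h4 := conj_add_ne hpp (-α) j
  have e1 : p i ^ 2 + (α : ℂ) ^ 2
      = (p i - Complex.I * α) * (p i - Complex.I * (-α : ℝ)) := by
    push_cast; linear_combination α ^ 2 * Complex.I_sq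
  have e2 : conj (p j) ^ 2 + (α : ℂ) ^ 2
      = (conj (p j) + Complex.I * α) * (conj (p j) + Complex.I * (-α : ℝ)) := by
    push_cast; linear_combination α ^ 2 * Complex.I_sq
  have e3 : p i * conj (p j) + (α : ℂ) ^ 2 = 1 / 2 *
      ((p i - Complex.I * α) * (conj (p j) + Complex.I * α) +
        (p i - Complex.I * (-α : ℝ)) * (conj (p j) + Complex.I * (-α : ℝ))) := by
    push_cast; linear_combination α ^ 2 * Complex.I_sq
  have h5 : coeff c₁ c₂ ρ₁ α p D i j * coeffDenom c₁ ρ₁ α p i j = c₂ * conj (D i) * D j :=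
    div_mul_cancel₀ _ (hc i j)
  rw [← mul_assoc, ← h5, coeffDenom, e1, e2, e3]
  generalize coeff c₁ c₂ ρ₁ α p D i j = C at *
  generalize p i - Complex.I * α = A at *
  generalize conj (p j) + Complex.I * α = B at *
  generalize p i - Complex.I * (-α : ℝ) = A' at *
  generalize conj (p j) + Complex.I * (-α : ℝ) = B' at *
  field_simp
  ring

/-- `coeff_reduction`, read as an identity of matrices and placed between two copies of M⁻¹. Its
left side has rank one and factors; the unweighted c on its right becomes moments by the original
Sylvester equation. -/
lemma sylvester_reduction (hpp : ∀ i j, p i + conj (p j) ≠ 0)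
    (hc : ∀ i j, coeffDenom c₁ ρ₁ α p i j ≠ 0)
    (hf : f c₁ c₂ ρ₁ α p ξ₀ D x t ≠ 0) (b : Fin N → ℂ)
    {m : Matrix (Fin N) (Fin N) ℂ} (hm : m = M c₁ c₂ ρ₁ α p ξ₀ D 0 x t)
    {φ ψ : Fin N → ℂ} (hφ : φ = expXi c₁ ρ₁ p ξ₀ x t) (hψ : ψ = expXiConj c₁ ρ₁ p ξ₀ x t) :
    (c₂ : ℂ) * pairing m ψ (fun j => conj (D j)) * pairing m D b =
      c₁ * ρ₁ ^ 2 * (ψ ⬝ᵥ m⁻¹ *ᵥ (of fun i j => coeff c₁ c₂ ρ₁ α p D i j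
          / ((p i - Complex.I * α) * (conj (p j) + Complex.I * α))) *ᵥ m⁻¹ *ᵥ b)
      + c₁ * ρ₁ ^ 2 * (ψ ⬝ᵥ m⁻¹ *ᵥ (of fun i j => coeff c₁ c₂ ρ₁ α p D i j
          / ((p i - Complex.I * (-α : ℝ)) * (conj (p j) + Complex.I * (-α : ℝ)))) *ᵥ m⁻¹ *ᵥ b)
      - (pairing m ((fun j => conj (p j)) * ψ) b + pairing m ψ (p * b)
        - pairing m ψ φ * pairing m ψ b) := by
  have hdet : m.det ≠ 0 := by rw [hm]; exact hf
  have h1 := pairing_sylvester hdet p (fun j => conj (p j)) φ ψ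
    (of fun i j => coeff c₁ c₂ ρ₁ α p D i j)
    (fun i j => by rw [hm, hφ, hψ]; exact M_sylvester hpp i j) ψ b
  have h2 : (c₂ : ℂ) • vecMulVec (fun i => conj (D i)) D =
      ((c₁ : ℂ) * ρ₁ ^ 2) • (of fun i j => coeff c₁ c₂ ρ₁ α p D i j
          / ((p i - Complex.I * α) * (conj (p j) + Complex.I * α)))
      + ((c₁ : ℂ) * ρ₁ ^ 2) • (of fun i j => coeff c₁ c₂ ρ₁ α p D i j
          / ((p i - Complex.I * (-α : ℝ)) * (conj (p j) + Complex.I * (-α : ℝ))))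
      + (-1 : ℂ) • (of fun i j => coeff c₁ c₂ ρ₁ α p D i j) := by
    ext i j
    simp only [Matrix.add_apply, Matrix.smul_apply, of_apply, vecMulVec_apply, smul_eq_mul]
    rw [coeff_reduction hpp hc i j]
    ring
  have h3 := congrArg (fun K => ψ ⬝ᵥ m⁻¹ *ᵥ K *ᵥ m⁻¹ *ᵥ b) h2
  simp only [add_mulVec, smul_mulVec, mulVec_add, mulVec_smul, dotProduct_add, dotProduct_smul,
    dotProduct_rank_one, smul_eq_mul] at h3
  simp only [pairing] at h1 ⊢
  linear_combination h3 + h1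

/-- Expanding (1 - ⟨ψ, Aφ⟩)(1 - ⟨Bψ, φ⟩), where A and B are the resolvents, gives exactly the terms
of the resolvent Sylvester equation. -/
lemma conj_darkAmp_mul_zero (hpp : ∀ i j, p i + conj (p j) ≠ 0)
    (hf : f c₁ c₂ ρ₁ α p ξ₀ D x t ≠ 0) (a : ℝ) :
    conj (darkAmp c₁ c₂ ρ₁ α p ξ₀ D a 0 x t) * darkAmp c₁ c₂ ρ₁ α p ξ₀ D a 0 x t
      = ρ₁ ^ 2 * (1 - resolventForm c₁ c₂ ρ₁ α p ξ₀ D a x t (expXi c₁ ρ₁ p ξ₀ x t)) := by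
  rw [conj_darkAmp_zero, darkAmp_zero, mul_mul_mul_comm, planeWave_mul_conj, resolventForm]
  linear_combination (-(ρ₁ : ℂ) ^ 2) *
    sylvester_resolvent hpp hf a (expXi c₁ ρ₁ p ξ₀ x t) rfl rfl rfl

lemma conj_darkAmp_mul_one (hpp : ∀ i j, p i + conj (p j) ≠ 0)
    (hf : f c₁ c₂ ρ₁ α p ξ₀ D x t ≠ 0) (a : ℝ) :
    conj (darkAmp c₁ c₂ ρ₁ α p ξ₀ D a 0 x t) * darkAmp c₁ c₂ ρ₁ α p ξ₀ D a 1 x t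
      = ρ₁ ^ 2 * (Complex.I * a + solMoment c₁ c₂ ρ₁ α p ξ₀ D 0 0 x t
        - resolventForm c₁ c₂ ρ₁ α p ξ₀ D a x t (p * expXi c₁ ρ₁ p ξ₀ x t)) := by
  rw [conj_darkAmp_zero, darkAmp_eq, mul_mul_mul_comm, planeWave_mul_conj, resolventForm]
  have h := sylvester_resolvent hpp hf a (p * expXi c₁ ρ₁ p ξ₀ x t) rfl rfl rfl
  -- From p/(p - ia) = 1 + ia/(p - ia); the summand 1 produces the moment s₀₀.
  have e : (fun j => (p * expXi c₁ ρ₁ p ξ₀ x t) j / (p j - Complex.I * a))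
      = expXi c₁ ρ₁ p ξ₀ x t
        + (Complex.I * a) • fun j => expXi c₁ ρ₁ p ξ₀ x t j / (p j - Complex.I * a) := by
    ext j
    have := sub_ne hpp a j
    simp only [Pi.mul_apply, Pi.add_apply, Pi.smul_apply, smul_eq_mul]
    field_simp
    ring
  rw [e, pairing_add_right, pairing_smul_right] at h
  simp only [pow_one, solMoment, moment, pow_zero, one_mul]
  linear_combination (-(ρ₁ : ℂ) ^ 2) * h

/-- The resolvent forms at α and -α from the dark components cancel those from the bright one; only
moments survive. The same happens in `bilinear_one`, where the terms ±iα cancel as well. -/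
lemma bilinear_zero (hpp : ∀ i j, p i + conj (p j) ≠ 0)
    (hc : ∀ i j, coeffDenom c₁ ρ₁ α p i j ≠ 0)
    (hf : f c₁ c₂ ρ₁ α p ξ₀ D x t ≠ 0) {s : ℕ → ℕ → ℂ}
    (hs : s = fun j k => solMoment c₁ c₂ ρ₁ α p ξ₀ D j k x t) :
    c₁ * (conj (darkAmp c₁ c₂ ρ₁ α p ξ₀ D α 0 x t) * darkAmp c₁ c₂ ρ₁ α p ξ₀ D α 0 x t
      + conj (darkAmp c₁ c₂ ρ₁ α p ξ₀ D (-α) 0 x t) * darkAmp c₁ c₂ ρ₁ α p ξ₀ D (-α) 0 x t)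
      + c₂ * conj (brightAmp c₁ c₂ ρ₁ α p ξ₀ D 0 x t) * brightAmp c₁ c₂ ρ₁ α p ξ₀ D 0 x t
      = 2 * c₁ * ρ₁ ^ 2 - (s 1 0 + s 0 1 - s 0 0 ^ 2) := by
  subst hs
  rw [conj_darkAmp_mul_zero hpp hf, conj_darkAmp_mul_zero hpp hf, conj_brightAmp_zero,
    brightAmp_eq, pow_zero, one_mul,
    sylvester_reduction hpp hc hf (expXi c₁ ρ₁ p ξ₀ x t) rfl rfl rfl]
  simp only [solMoment, moment, pow_zero, one_mul, pow_one, resolventForm]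
  ring

lemma bilinear_one (hpp : ∀ i j, p i + conj (p j) ≠ 0)
    (hc : ∀ i j, coeffDenom c₁ ρ₁ α p i j ≠ 0)
    (hf : f c₁ c₂ ρ₁ α p ξ₀ D x t ≠ 0) {s : ℕ → ℕ → ℂ}
    (hs : s = fun j k => solMoment c₁ c₂ ρ₁ α p ξ₀ D j k x t) :
    c₁ * (conj (darkAmp c₁ c₂ ρ₁ α p ξ₀ D α 0 x t) * darkAmp c₁ c₂ ρ₁ α p ξ₀ D α 1 x t
      + conj (darkAmp c₁ c₂ ρ₁ α p ξ₀ D (-α) 0 x t) * darkAmp c₁ c₂ ρ₁ α p ξ₀ D (-α) 1 x t)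
      + c₂ * conj (brightAmp c₁ c₂ ρ₁ α p ξ₀ D 0 x t) * brightAmp c₁ c₂ ρ₁ α p ξ₀ D 1 x t
      = 2 * c₁ * ρ₁ ^ 2 * s 0 0 - (s 1 1 + s 0 2 - s 0 0 * s 0 1) := by
  subst hs
  rw [conj_darkAmp_mul_one hpp hf, conj_darkAmp_mul_one hpp hf, conj_brightAmp_zero,
    brightAmp_eq, pow_one,
    sylvester_reduction hpp hc hf (p * expXi c₁ ρ₁ p ξ₀ x t) rfl rfl rfl]
  simp only [solMoment, moment, pow_zero, one_mul, pow_one, resolventForm, ← mul_assoc, ← sq]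
  push_cast
  ring

end DarkBright

/-! ### Complexification of real derivatives, and smoothness. -/

namespace DarkBright
open Matrix Filter

/-- No differentiability is needed, as both sides are 0 otherwise. It allows the real equation for v
to be checked over ℂ. -/
lemma deriv_ofReal_comp (v : ℝ → ℝ) :
    deriv (fun y => (v y : ℂ)) = fun y => ((deriv v y : ℝ) : ℂ) := by
  ext y
  by_cases h : DifferentiableAt ℝ v y
  · exact h.hasDerivAt.ofReal_comp.deriv
  · rw [deriv_zero_of_not_differentiableAt h, deriv_zero_of_not_differentiableAt,
      Complex.ofReal_zero]
    intro h'
    exact h (Complex.reCLM.differentiableAt.comp y h')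

lemma iteratedDeriv_three_ofReal_comp (v : ℝ → ℝ) (x : ℝ) :
    iteratedDeriv 3 (fun y => (v y : ℂ)) x = ((iteratedDeriv 3 v x : ℝ) : ℂ) := by
  simp only [iteratedDeriv_succ, iteratedDeriv_zero, deriv_ofReal_comp]

lemma contDiff_det {n : Type*} [Fintype n] [DecidableEq n] {E : Type*} [NormedAddCommGroup E]
    [NormedSpace ℝ E] {k : WithTop ℕ∞} {A : E → Matrix n n ℂ}
    (h : ∀ i j, ContDiff ℝ k fun z => A z i j) : ContDiff ℝ k fun z => (A z).det := by
  simp only [det_apply]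
  exact ContDiff.sum fun σ _ => (contDiff_prod fun i _ => h _ _).const_smul _

lemma contDiffAt_div {E : Type*} [NormedAddCommGroup E] [NormedSpace ℝ E] {k : WithTop ℕ∞}
    {g h : E → ℂ} {z : E} (hg : ContDiff ℝ k g) (hh : ContDiff ℝ k h) (hz : h z ≠ 0) :
    ContDiffAt ℝ k (fun z => g z / h z) z := by
  simp only [div_eq_mul_inv]
  exact hg.contDiffAt.mul (hh.contDiffAt.inv hz)

section smoothness

variable {N : ℕ} {c₁ c₂ ρ₁ α : ℝ} {p ξ₀ D : Fin N → ℂ}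

lemma contDiff_xi (i : Fin N) :
    ContDiff ℝ 3 (fun z : ℝ × ℝ => xi c₁ ρ₁ p ξ₀ z.1 z.2 i) := by
  have h : ContDiff ℝ 3 ((↑) : ℝ → ℂ) := Complex.ofRealCLM.contDiff
  unfold xi
  fun_prop

lemma contDiff_M (q : ℕ) (i j : Fin N) :
    ContDiff ℝ 3 (fun z : ℝ × ℝ => M c₁ c₂ ρ₁ α p ξ₀ D q z.1 z.2 i j) := by
  have hi := contDiff_xi (c₁ := c₁) (ρ₁ := ρ₁) (p := p) (ξ₀ := ξ₀) i
  have hj : ContDiff ℝ 3 (fun z : ℝ × ℝ => conj (xi c₁ ρ₁ p ξ₀ z.1 z.2 j)) :=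
    Complex.conjCLE.contDiff.comp (contDiff_xi j)
  simp only [M, of_apply]
  fun_prop

lemma contDiff_f : ContDiff ℝ 3 (fun z : ℝ × ℝ => f c₁ c₂ ρ₁ α p ξ₀ D z.1 z.2) :=
  contDiff_det (contDiff_M 0)

lemma contDiff_h₁ : ContDiff ℝ 3 (fun z : ℝ × ℝ => h₁ c₁ c₂ ρ₁ α p ξ₀ D z.1 z.2) :=
  contDiff_det (contDiff_M 1)

lemma contDiff_g₂ : ContDiff ℝ 3 (fun z : ℝ × ℝ => g₂ c₁ c₂ ρ₁ α p ξ₀ D z.1 z.2) := by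
  refine contDiff_det ?_
  rintro (i | i) (j | j)
  · exact contDiff_M 0 i j
  · exact (contDiff_xi i).cexp
  · exact contDiff_const
  · exact contDiff_const

lemma contDiffOn_u : ContDiffOn ℝ 3 (fun z : ℝ × ℝ => u c₁ c₂ ρ₁ α p ξ₀ D z.1 z.2)
    {z : ℝ × ℝ | f c₁ c₂ ρ₁ α p ξ₀ D z.1 z.2 ≠ 0} := by
  have h : ContDiff ℝ 3 ((↑) : ℝ → ℂ) := Complex.ofRealCLM.contDiff
  have h1 : ContDiff ℝ 3 (fun z : ℝ × ℝ =>
      Complex.exp (Complex.I * (α * z.1 - (α ^ 3 + 6 * c₁ * α * ρ₁ ^ 2) * z.2))) := by fun_prop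
  intro z hz
  exact ((contDiffAt_const.mul (contDiffAt_div contDiff_h₁ contDiff_f hz)).mul
    h1.contDiffAt).contDiffWithinAt

lemma contDiffOn_g₂_div_f_re : ContDiffOn ℝ 3
    (fun z : ℝ × ℝ => (g₂ c₁ c₂ ρ₁ α p ξ₀ D z.1 z.2 / f c₁ c₂ ρ₁ α p ξ₀ D z.1 z.2).re)
    {z : ℝ × ℝ | f c₁ c₂ ρ₁ α p ξ₀ D z.1 z.2 ≠ 0} :=
  fun z hz => (Complex.reCLM.contDiff.contDiffAt.comp z
    (contDiffAt_div contDiff_g₂ contDiff_f hz)).contDiffWithinAt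

lemma isOpen_f_ne_zero : IsOpen {z : ℝ × ℝ | f c₁ c₂ ρ₁ α p ξ₀ D z.1 z.2 ≠ 0} :=
  isOpen_ne_fun contDiff_f.continuous continuous_const

lemma eventually_f_ne_zero {x t : ℝ} (hf : f c₁ c₂ ρ₁ α p ξ₀ D x t ≠ 0) :
    ∀ᶠ y in 𝓝 x, f c₁ c₂ ρ₁ α p ξ₀ D y t ≠ 0 := by
  have : Continuous fun y : ℝ => (y, t) := by fun_prop
  exact (isOpen_f_ne_zero.preimage this).mem_nhds hf

lemma eventually_f_ne_zero_time {x t : ℝ} (hf : f c₁ c₂ ρ₁ α p ξ₀ D x t ≠ 0) :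
    ∀ᶠ s in 𝓝 t, f c₁ c₂ ρ₁ α p ξ₀ D x s ≠ 0 := by
  have : Continuous fun s : ℝ => (x, s) := by fun_prop
  exact (isOpen_f_ne_zero.preimage this).mem_nhds hf

end smoothness

/-! ### Evolution of the amplitudes in x and t. -/

section flows

variable {N : ℕ} {c₁ c₂ ρ₁ α : ℝ} {p ξ₀ D : Fin N → ℂ} (x t : ℝ)

lemma hasDerivAt_xi (i : Fin N) :
    HasDerivAt (fun y => xi c₁ ρ₁ p ξ₀ y t i) (p i) x := by
  have h : HasDerivAt (fun y : ℝ => (y : ℂ)) 1 x := Complex.ofRealCLM.hasDerivAt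
  exact ((((h.sub_const _).const_mul (p i)).add_const _).add_const _).congr_deriv (by simp)

lemma hasDerivAt_xi_time (i : Fin N) :
    HasDerivAt (fun s => xi c₁ ρ₁ p ξ₀ x s i) (p i ^ 3 - 3 * (2 * c₁ * ρ₁ ^ 2) * p i) t := by
  have h : HasDerivAt (fun y : ℝ => (y : ℂ)) 1 t := Complex.ofRealCLM.hasDerivAt
  exact (((((h.const_mul (6 * (c₁ : ℂ) * ρ₁ ^ 2)).const_sub (x : ℂ)).const_mul (p i)).add
    (h.const_mul (p i ^ 3))).add_const _).congr_deriv (by ring)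

lemma hasDerivAt_conj {g : ℝ → ℂ} {g' : ℂ} {y : ℝ} (h : HasDerivAt g g' y) :
    HasDerivAt (fun z => conj (g z)) (conj g') y :=
  (Complex.conjCLE : ℂ →L[ℝ] ℂ).hasFDerivAt.comp_hasDerivAt y h

lemma hasDerivAt_expXi (i : Fin N) : HasDerivAt (fun y => expXi c₁ ρ₁ p ξ₀ y t i)
    (p i * expXi c₁ ρ₁ p ξ₀ x t i) x :=
  (hasDerivAt_xi x t i).cexp.congr_deriv (mul_comm _ _)

lemma hasDerivAt_expXiConj (i : Fin N) : HasDerivAt (fun y => expXiConj c₁ ρ₁ p ξ₀ y t i)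
    (conj (p i) * expXiConj c₁ ρ₁ p ξ₀ x t i) x :=
  (hasDerivAt_conj (hasDerivAt_xi x t i)).cexp.congr_deriv (mul_comm _ _)

lemma hasDerivAt_expXi_time (i : Fin N) : HasDerivAt (fun s => expXi c₁ ρ₁ p ξ₀ x s i)
    ((p i ^ 3 - 3 * (2 * c₁ * ρ₁ ^ 2) * p i) * expXi c₁ ρ₁ p ξ₀ x t i) t :=
  (hasDerivAt_xi_time x t i).cexp.congr_deriv (mul_comm _ _)

lemma hasDerivAt_expXiConj_time (i : Fin N) : HasDerivAt (fun s => expXiConj c₁ ρ₁ p ξ₀ x s i)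
    ((conj (p i) ^ 3 - 3 * (2 * c₁ * ρ₁ ^ 2) * conj (p i)) * expXiConj c₁ ρ₁ p ξ₀ x t i) t :=
  (hasDerivAt_conj (hasDerivAt_xi_time x t i)).cexp.congr_deriv
    (by rw [mul_comm]; simp [expXiConj, map_ofNat])

lemma hasDerivAt_M (hpp : ∀ i j, p i + conj (p j) ≠ 0) (i j : Fin N) :
    HasDerivAt (fun y => M c₁ c₂ ρ₁ α p ξ₀ D 0 y t i j)
      (expXi c₁ ρ₁ p ξ₀ x t i * expXiConj c₁ ρ₁ p ξ₀ x t j) x := by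
  simp only [M_zero_apply]
  refine ((((hasDerivAt_expXi x t i).mul (hasDerivAt_expXiConj x t j)).add_const _).div_const
    _).congr_deriv ?_
  have := hpp i j
  field_simp

lemma hasDerivAt_M_time (hpp : ∀ i j, p i + conj (p j) ≠ 0) (i j : Fin N) :
    HasDerivAt (fun s => M c₁ c₂ ρ₁ α p ξ₀ D 0 x s i j)
      ((p i ^ 2 - p i * conj (p j) + conj (p j) ^ 2 - 3 * (2 * c₁ * ρ₁ ^ 2)) *
        (expXi c₁ ρ₁ p ξ₀ x t i * expXiConj c₁ ρ₁ p ξ₀ x t j)) t := by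
  simp only [M_zero_apply]
  refine ((((hasDerivAt_expXi_time x t i).mul (hasDerivAt_expXiConj_time x t j)).add_const
    _).div_const _).congr_deriv ?_
  have := hpp i j
  field_simp
  ring

lemma hasDerivAt_planeWave (a : ℝ) : HasDerivAt (fun y => planeWave c₁ ρ₁ a y t)
    (Complex.I * a * planeWave c₁ ρ₁ a x t) x := by
  have h : HasDerivAt (fun y : ℝ => (y : ℂ)) 1 x := Complex.ofRealCLM.hasDerivAt
  refine ((((h.const_mul (a : ℂ)).sub_const _).const_mul Complex.I).cexp.const_mul
    (ρ₁ : ℂ)).congr_deriv ?_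
  simp only [planeWave]
  ring

lemma hasDerivAt_planeWave_time (a : ℝ) : HasDerivAt (fun s => planeWave c₁ ρ₁ a x s)
    (((Complex.I * a) ^ 3 - 3 * (2 * c₁ * ρ₁ ^ 2) * (Complex.I * a)) * planeWave c₁ ρ₁ a x t)
    t := by
  have h : HasDerivAt (fun y : ℝ => (y : ℂ)) 1 t := Complex.ofRealCLM.hasDerivAt
  refine ((((h.const_mul ((a : ℂ) ^ 3 + 6 * c₁ * a * ρ₁ ^ 2)).const_sub (a * x : ℂ)).const_mul
    Complex.I).cexp.const_mul (ρ₁ : ℂ)).congr_deriv ?_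
  simp only [planeWave, mul_pow, Complex.I_pow_three]
  ring

/-- A family of functions of `(x, t)` that evolves like `darkAmp` and `brightAmp` do. -/
def IsAmplitude (c₁ c₂ ρ₁ α : ℝ) (p ξ₀ D : Fin N → ℂ) (d : ℕ → ℝ → ℝ → ℂ) : Prop :=
  ∀ x t, f c₁ c₂ ρ₁ α p ξ₀ D x t ≠ 0 →
    (∀ k, HasDerivAt (fun y => d k y t)
      (d (k + 1) x t - solMoment c₁ c₂ ρ₁ α p ξ₀ D 0 k x t * d 0 x t) x) ∧
    HasDerivAt (fun s => d 0 x s)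
      (d 3 x t - 3 * (2 * c₁ * ρ₁ ^ 2) * d 1 x t - solMoment c₁ c₂ ρ₁ α p ξ₀ D 0 0 x t * d 2 x t
        + solMoment c₁ c₂ ρ₁ α p ξ₀ D 1 0 x t * d 1 x t
        - solMoment c₁ c₂ ρ₁ α p ξ₀ D 2 0 x t * d 0 x t
        + 3 * (2 * c₁ * ρ₁ ^ 2) * solMoment c₁ c₂ ρ₁ α p ξ₀ D 0 0 x t * d 0 x t) t

/-- With β = ia and q = p_j*, the denominator q + β divides both β + q and β³ + q³ - 3κ(β + q), the
logarithmic derivatives of E ψ_j in x and t. This is what the dressing recursions require. -/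
lemma isAmplitude_darkAmp (hpp : ∀ i j, p i + conj (p j) ≠ 0) (a : ℝ) :
    IsAmplitude c₁ c₂ ρ₁ α p ξ₀ D (darkAmp c₁ c₂ ρ₁ α p ξ₀ D a) := by
  intro x t hf
  constructor
  · intro k
    refine hasDerivAt_dressed (φ := fun y => expXi c₁ ρ₁ p ξ₀ y t)
      (ψ := fun y => expXiConj c₁ ρ₁ p ξ₀ y t) (M := fun y => M c₁ c₂ ρ₁ α p ξ₀ D 0 y t)
      (fun i => hasDerivAt_expXi x t i) (fun i j => hasDerivAt_M x t hpp i j) (fun i => ?_)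
      (hasDerivAt_planeWave x t a) hf k
    refine (((hasDerivAt_planeWave x t a).mul (hasDerivAt_expXiConj x t i)).div_const
      _).congr_deriv ?_
    have := conj_add_ne hpp a i
    field_simp
    ring
  · refine hasDerivAt_dressed_time (φ := fun s => expXi c₁ ρ₁ p ξ₀ x s)
      (ψ := fun s => expXiConj c₁ ρ₁ p ξ₀ x s) (M := fun s => M c₁ c₂ ρ₁ α p ξ₀ D 0 x s)
      (q := fun i => conj (p i)) (κ := 2 * c₁ * ρ₁ ^ 2)
      (fun i => hasDerivAt_expXi_time x t i) (fun i j => hasDerivAt_M_time x t hpp i j)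
      (fun i => ?_) (hasDerivAt_planeWave_time x t a) hf
      (s := fun j k => solMoment c₁ c₂ ρ₁ α p ξ₀ D j k x t)
      (d := fun k => darkAmp c₁ c₂ ρ₁ α p ξ₀ D a k x t) rfl rfl
    refine (((hasDerivAt_planeWave_time x t a).mul (hasDerivAt_expXiConj_time x t i)).div_const
      _).congr_deriv ?_
    have := conj_add_ne hpp a i
    field_simp
    ring

lemma isAmplitude_brightAmp (hpp : ∀ i j, p i + conj (p j) ≠ 0) :
    IsAmplitude c₁ c₂ ρ₁ α p ξ₀ D (brightAmp c₁ c₂ ρ₁ α p ξ₀ D) := by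
  intro x t hf
  constructor
  · exact fun k => hasDerivAt_dressed (φ := fun y => expXi c₁ ρ₁ p ξ₀ y t)
      (ψ := fun y => expXiConj c₁ ρ₁ p ξ₀ y t) (M := fun y => M c₁ c₂ ρ₁ α p ξ₀ D 0 y t)
      (a := fun _ => -D) (E := fun _ => 0)
      (fun i => hasDerivAt_expXi x t i) (fun i j => hasDerivAt_M x t hpp i j)
      (fun i => (hasDerivAt_const x _).congr_deriv (by simp))
      ((hasDerivAt_const x _).congr_deriv (by simp)) hf k
  · exact hasDerivAt_dressed_time (φ := fun s => expXi c₁ ρ₁ p ξ₀ x s)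
      (ψ := fun s => expXiConj c₁ ρ₁ p ξ₀ x s) (M := fun s => M c₁ c₂ ρ₁ α p ξ₀ D 0 x s)
      (q := fun i => conj (p i)) (κ := 2 * c₁ * ρ₁ ^ 2)
      (a := fun _ => -D) (E := fun _ => 0)
      (fun i => hasDerivAt_expXi_time x t i) (fun i j => hasDerivAt_M_time x t hpp i j)
      (fun i => (hasDerivAt_const t _).congr_deriv (by simp))
      ((hasDerivAt_const t _).congr_deriv (by simp)) hf
      (s := fun j k => solMoment c₁ c₂ ρ₁ α p ξ₀ D j k x t)
      (d := fun k => brightAmp c₁ c₂ ρ₁ α p ξ₀ D k x t) rfl rfl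

variable {x t}

/-- Every amplitude solves one linear equation, whose coefficients depend on the moments only. -/
lemma IsAmplitude.evolution {d : ℕ → ℝ → ℝ → ℂ} (hd : IsAmplitude c₁ c₂ ρ₁ α p ξ₀ D d)
    (hpp : ∀ i j, p i + conj (p j) ≠ 0) (hf : f c₁ c₂ ρ₁ α p ξ₀ D x t ≠ 0)
    {s : ℕ → ℕ → ℂ} (hs : s = fun j k => solMoment c₁ c₂ ρ₁ α p ξ₀ D j k x t) :
    deriv (fun r => d 0 x r) t = iteratedDeriv 3 (fun y => d 0 y t) x
      - 3 * (2 * c₁ * ρ₁ ^ 2 - (s 1 0 + s 0 1 - s 0 0 ^ 2)) * (d 1 x t - s 0 0 * d 0 x t)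
      - 3 * (s 0 0 * (s 1 0 + s 0 1 - s 0 0 ^ 2) - s 1 1 - s 0 2 + s 0 0 * s 0 1) * d 0 x t := by
  subst hs
  have hev := eventually_f_ne_zero hf
  rw [(hd x t hf).2.deriv, iteratedDeriv_three_of_recursion (d := fun k y => d k y t)
    (s := fun j k y => solMoment c₁ c₂ ρ₁ α p ξ₀ D j k y t)
    (hev.mono fun y hy => (hd y t hy).1)
    (hev.mono fun y hy j k => hasDerivAt_moment (φ := fun y => expXi c₁ ρ₁ p ξ₀ y t)
      (ψ := fun y => expXiConj c₁ ρ₁ p ξ₀ y t) (M := fun y => M c₁ c₂ ρ₁ α p ξ₀ D 0 y t)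
      (fun i => hasDerivAt_expXi y t i) (fun i => hasDerivAt_expXiConj y t i)
      (fun i j => hasDerivAt_M y t hpp i j) hy j k)]
  ring

end flows

/-! ### From the linear equation to the nonlinear system. -/

section system

variable {N : ℕ} {c₁ c₂ ρ₁ α : ℝ} {p ξ₀ D : Fin N → ℂ}

lemma g₂_div_f_re (hp : ∀ i, conj (p i.rev) = p i) (hξ : ∀ i, conj (ξ₀ i.rev) = ξ₀ i)
    (hD : ∀ i, conj (D i) = D i.rev) (x t : ℝ) :
    ((g₂ c₁ c₂ ρ₁ α p ξ₀ D x t / f c₁ c₂ ρ₁ α p ξ₀ D x t).re : ℂ)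
      = g₂ c₁ c₂ ρ₁ α p ξ₀ D x t / f c₁ c₂ ρ₁ α p ξ₀ D x t := by
  by_cases hf : f c₁ c₂ ρ₁ α p ξ₀ D x t = 0
  · simp [hf]
  · rw [g₂_div_f hf]
    exact Complex.conj_eq_iff_re.1 (conj_brightAmp_zero_eq_self hp hξ hD)

theorem isSSmKdVSolutionOn (hp : ∀ i, conj (p i.rev) = p i) (hξ : ∀ i, conj (ξ₀ i.rev) = ξ₀ i)
    (hD : ∀ i, conj (D i) = D i.rev) (hpp : ∀ i j, p i + conj (p j) ≠ 0)
    (hc : ∀ i j, coeffDenom c₁ ρ₁ α p i j ≠ 0) :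
    IsSSmKdVSolutionOn c₁ c₂ (u c₁ c₂ ρ₁ α p ξ₀ D)
      (fun x t => (g₂ c₁ c₂ ρ₁ α p ξ₀ D x t / f c₁ c₂ ρ₁ α p ξ₀ D x t).re)
      {q : ℝ × ℝ | f c₁ c₂ ρ₁ α p ξ₀ D q.1 q.2 ≠ 0} := by
  refine ⟨isOpen_f_ne_zero, contDiffOn_u, contDiffOn_g₂_div_f_re, fun x t hf => ?_⟩
  change f c₁ c₂ ρ₁ α p ξ₀ D x t ≠ 0 at hf
  set v : ℝ → ℝ → ℝ := fun x t => (g₂ c₁ c₂ ρ₁ α p ξ₀ D x t / f c₁ c₂ ρ₁ α p ξ₀ D x t).re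
    with hv
  have hvb : ∀ y s, f c₁ c₂ ρ₁ α p ξ₀ D y s ≠ 0 →
      (v y s : ℂ) = brightAmp c₁ c₂ ρ₁ α p ξ₀ D 0 y s :=
    fun y s h => (g₂_div_f_re hp hξ hD y s).trans (g₂_div_f h)
  have hnorm : ∀ y s, f c₁ c₂ ρ₁ α p ξ₀ D y s ≠ 0 → ((‖u c₁ c₂ ρ₁ α p ξ₀ D y s‖ ^ 2 : ℝ) : ℂ)
      = darkAmp c₁ c₂ ρ₁ α p ξ₀ D α 0 y s * darkAmp c₁ c₂ ρ₁ α p ξ₀ D (-α) 0 y s := by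
    intro y s h
    rw [← conj_darkAmp_zero_eq_neg hp hξ hD, u_eq_darkAmp hpp h, Complex.mul_conj,
      Complex.normSq_eq_norm_sq]
  have hev := eventually_f_ne_zero hf
  have hevt := eventually_f_ne_zero_time hf
  have hux : (fun y => u c₁ c₂ ρ₁ α p ξ₀ D y t) =ᶠ[𝓝 x]
      fun y => darkAmp c₁ c₂ ρ₁ α p ξ₀ D α 0 y t := hev.mono fun y hy => u_eq_darkAmp hpp hy
  have hut : (fun s => u c₁ c₂ ρ₁ α p ξ₀ D x s) =ᶠ[𝓝 t]
      fun s => darkAmp c₁ c₂ ρ₁ α p ξ₀ D α 0 x s := hevt.mono fun y hy => u_eq_darkAmp hpp hy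
  have hvx : (fun y => (v y t : ℂ)) =ᶠ[𝓝 x]
      fun y => brightAmp c₁ c₂ ρ₁ α p ξ₀ D 0 y t := hev.mono fun y hy => hvb y t hy
  have hvt : (fun s => (v x s : ℂ)) =ᶠ[𝓝 t]
      fun s => brightAmp c₁ c₂ ρ₁ α p ξ₀ D 0 x s := hevt.mono fun y hy => hvb x y hy
  have hnx : (fun y => ((‖u c₁ c₂ ρ₁ α p ξ₀ D y t‖ ^ 2 : ℝ) : ℂ)) =ᶠ[𝓝 x] fun y =>
      darkAmp c₁ c₂ ρ₁ α p ξ₀ D α 0 y t * darkAmp c₁ c₂ ρ₁ α p ξ₀ D (-α) 0 y t :=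
    hev.mono fun y hy => hnorm y t hy
  have a1 := isAmplitude_darkAmp (c₁ := c₁) (c₂ := c₂) (ρ₁ := ρ₁) (α := α) (ξ₀ := ξ₀) (D := D)
    hpp α
  have a2 := isAmplitude_darkAmp (c₁ := c₁) (c₂ := c₂) (ρ₁ := ρ₁) (α := α) (ξ₀ := ξ₀) (D := D)
    hpp (-α)
  have a3 := isAmplitude_brightAmp (c₁ := c₁) (c₂ := c₂) (ρ₁ := ρ₁) (α := α) (ξ₀ := ξ₀) (D := D)
    hpp
  have b0 := bilinear_zero hpp hc hf rfl
  have b1 := bilinear_one hpp hc hf rfl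
  have e1 := a1.evolution hpp hf rfl
  have e3 := a3.evolution hpp hf rfl
  have d1 := (a1 x t hf).1 0
  have d2 := (a2 x t hf).1 0
  have d3 := (a3 x t hf).1 0
  have cj := conj_darkAmp_zero_eq_neg (c₁ := c₁) (c₂ := c₂) (ρ₁ := ρ₁) (α := α) (x := x) (t := t)
    hp hξ hD α
  have cj' := conj_darkAmp_zero_eq_neg (c₁ := c₁) (c₂ := c₂) (ρ₁ := ρ₁) (α := α) (x := x) (t := t)
    hp hξ hD (-α)
  rw [neg_neg] at cj'
  rw [cj, cj', conj_brightAmp_zero_eq_self hp hξ hD] at b0 b1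
  have hN := (congrFun (deriv_ofReal_comp fun y => ‖u c₁ c₂ ρ₁ α p ξ₀ D y t‖ ^ 2) x).symm
  rw [hnx.deriv_eq, (d1.fun_mul d2).deriv] at hN
  have hV := (congrFun (deriv_ofReal_comp fun y => v y t) x).symm
  rw [hvx.deriv_eq, d3.deriv] at hV
  have hVt := (congrFun (deriv_ofReal_comp fun s => v x s) t).symm
  rw [hvt.deriv_eq, e3] at hVt
  have hV3 := (iteratedDeriv_three_ofReal_comp (fun y => v y t) x).symm
  rw [hvx.iteratedDeriv_eq 3] at hV3
  constructor
  · rw [hut.deriv_eq, hux.iteratedDeriv_eq 3, hux.deriv_eq, (hux.fun_mul hvx).deriv_eq, e1,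
      (d1.fun_mul d3).deriv, d1.deriv, hN, hnorm x t hf, hvb x t hf, u_eq_darkAmp hpp hf]
    -- Here d₁ - s₀₀ d₀ is the x-derivative of the amplitude d₀. So b0 identifies the coefficient of
    -- that derivative, and b1 - s₀₀ b0, whose left side is c₁(|u|²)_x + c₂ v v_x, the coefficient
    -- of d₀.
    linear_combination
      3 * (darkAmp c₁ c₂ ρ₁ α p ξ₀ D α 1 x t - solMoment c₁ c₂ ρ₁ α p ξ₀ D 0 0 x t
        * darkAmp c₁ c₂ ρ₁ α p ξ₀ D α 0 x t) * b0
      + 3 * darkAmp c₁ c₂ ρ₁ α p ξ₀ D α 0 x t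
        * (b1 - solMoment c₁ c₂ ρ₁ α p ξ₀ D 0 0 x t * b0)
  · rw [← Complex.ofReal_inj]
    simp only [Complex.ofReal_sub, Complex.ofReal_mul, Complex.ofReal_ofNat]
    rw [hVt, ← hV3, hV, hN, hnorm x t hf, Complex.ofReal_pow, hvb x t hf]
    linear_combination
      3 * (brightAmp c₁ c₂ ρ₁ α p ξ₀ D 1 x t - solMoment c₁ c₂ ρ₁ α p ξ₀ D 0 0 x t
        * brightAmp c₁ c₂ ρ₁ α p ξ₀ D 0 x t) * b0
      + 3 * brightAmp c₁ c₂ ρ₁ α p ξ₀ D 0 x t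
        * (b1 - solMoment c₁ c₂ ρ₁ α p ξ₀ D 0 0 x t * b0)

end system
end DarkBright

/-! ### Cauchy determinants and behaviour as x → ±∞. -/

namespace DarkBright
open Matrix Filter

/-- A kernel vector y gives a polynomial of degree below the size of the matrix that vanishes at all
a_i, hence is zero; its value at -b_j is a nonzero multiple of y_j. -/
lemma det_cauchy_ne_zero {m : Type*} [Fintype m] [DecidableEq m] {a b : m → ℂ}
    (ha : Function.Injective a) (hb : Function.Injective b) (hab : ∀ i j, a i + b j ≠ 0) :
    (of fun i j => 1 / (a i + b j)).det ≠ 0 := by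
  intro h
  obtain ⟨y, hy, hy0⟩ := exists_mulVec_eq_zero_iff.2 h
  apply hy
  set P : Polynomial ℂ := ∑ j, Polynomial.C (y j) *
    ∏ k ∈ Finset.univ.erase j, (Polynomial.X + Polynomial.C (b k)) with hP
  have heval : ∀ i, P.eval (a i) = 0 := by
    intro i
    have h1 : ∑ j, 1 / (a i + b j) * y j = 0 := congrFun hy0 i
    have h2 : P.eval (a i) = (∏ k, (a i + b k)) * ∑ j, 1 / (a i + b j) * y j := by
      rw [hP, Polynomial.eval_finsetSum, Finset.mul_sum]
      refine Finset.sum_congr rfl fun j _ => ?_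
      rw [Polynomial.eval_mul, Polynomial.eval_prod, ← Finset.mul_prod_erase _ _
        (Finset.mem_univ j)]
      simp only [Polynomial.eval_C, Polynomial.eval_add, Polynomial.eval_X]
      have := hab i j
      field_simp
    rw [h2, h1, mul_zero]
  funext j
  have hdeg : P.natDegree < Fintype.card m := by
    have hpos : 0 < Fintype.card m := Fintype.card_pos_iff.2 ⟨j⟩
    refine lt_of_le_of_lt (Polynomial.natDegree_sum_le_of_forall_le (n := Fintype.card m - 1)
      _ _ fun k _ => ?_) (by omega)
    refine (Polynomial.natDegree_C_mul_le _ _).trans ((Polynomial.natDegree_prod_le _ _).trans ?_)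
    refine (Finset.sum_le_card_nsmul _ _ 1 fun l _ => ?_).trans ?_
    · exact (Polynomial.natDegree_X_add_C _).le
    · simp [Finset.card_erase_of_mem]
  have hzero : P = 0 := Polynomial.eq_zero_of_natDegree_lt_card_of_eval_eq_zero P ha heval hdeg
  have h3 : P.eval (-b j) = y j * ∏ k ∈ Finset.univ.erase j, (-b j + b k) := by
    rw [hP, Polynomial.eval_finsetSum, Finset.sum_eq_single j]
    · simp [Polynomial.eval_prod]
    · intro k _ hk
      rw [Polynomial.eval_mul, Polynomial.eval_prod,
        Finset.prod_eq_zero (Finset.mem_erase.2 ⟨hk.symm, Finset.mem_univ j⟩) (by simp), mul_zero]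
    · simp
  rw [hzero, Polynomial.eval_zero] at h3
  refine (mul_eq_zero.1 h3.symm).resolve_right (Finset.prod_ne_zero_iff.2 fun k hk h4 => ?_)
  exact (Finset.mem_erase.1 hk).1 (hb (by linear_combination h4))

lemma det_scale {m : Type*} [Fintype m] [DecidableEq m] (g k : m → ℂ) (A : Matrix m m ℂ) :
    (of fun i j => g i * A i j * k j).det = (∏ i, g i) * (∏ j, k j) * A.det := by
  have h : (of fun i j => g i * A i j * k j)
      = of fun i j => k j * (of fun i j => g i * A i j) i j := by
    ext i j; simp [mul_comm]
  rw [h, det_mul_row, det_mul_column]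
  ring

lemma tendsto_det {m X : Type*} [Fintype m] [DecidableEq m] {l : Filter X} {A : X → Matrix m m ℂ}
    {B : Matrix m m ℂ} (h : ∀ i j, Tendsto (fun x => A x i j) l (𝓝 (B i j))) :
    Tendsto (fun x => (A x).det) l (𝓝 B.det) := by
  simp only [det_apply]
  exact tendsto_finsetSum _ fun σ _ => (tendsto_finsetProd _ fun i _ => h _ _).const_smul _

section asymptotics

variable {N : ℕ} {c₁ c₂ ρ₁ α : ℝ} {p ξ₀ D : Fin N → ℂ}

/-- The numbers `r_i` with `r_i + r_j* = (p_i + p_j*) coeffDenom i j`. -/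
noncomputable def cauchyNode (c₁ ρ₁ α : ℝ) (z : ℂ) : ℂ :=
  2 * c₁ * ρ₁ ^ 2 * z / (z ^ 2 + α ^ 2) - z

lemma cauchyNode_add (hpp : ∀ i j, p i + conj (p j) ≠ 0) (i j : Fin N) :
    cauchyNode c₁ ρ₁ α (p i) + conj (cauchyNode c₁ ρ₁ α (p j))
      = (p i + conj (p j)) * coeffDenom c₁ ρ₁ α p i j := by
  have h1 : p i ^ 2 + (α : ℂ) ^ 2 ≠ 0 := by
    have e : p i ^ 2 + (α : ℂ) ^ 2
        = (p i - Complex.I * α) * (p i - Complex.I * (-α : ℝ)) := by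
      push_cast; linear_combination α ^ 2 * Complex.I_sq
    rw [e]
    exact mul_ne_zero (sub_ne hpp _ _) (sub_ne hpp _ _)
  have h2 : conj (p j) ^ 2 + (α : ℂ) ^ 2 ≠ 0 := by
    have e : conj (p j) ^ 2 + (α : ℂ) ^ 2
        = (conj (p j) + Complex.I * α) * (conj (p j) + Complex.I * (-α : ℝ)) := by
      push_cast; linear_combination α ^ 2 * Complex.I_sq
    rw [e]
    exact mul_ne_zero (conj_add_ne hpp _ _) (conj_add_ne hpp _ _)
  simp only [cauchyNode, coeffDenom, map_sub, map_div₀, map_mul, map_add, map_pow, map_ofNat,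
    Complex.conj_ofReal]
  field_simp
  ring

lemma coeff_div_eq (hpp : ∀ i j, p i + conj (p j) ≠ 0) (i j : Fin N) :
    coeff c₁ c₂ ρ₁ α p D i j / (p i + conj (p j)) = c₂ * conj (D i) *
      (1 / (cauchyNode c₁ ρ₁ α (p i) + conj (cauchyNode c₁ ρ₁ α (p j)))) * D j := by
  rw [cauchyNode_add hpp, coeff, div_div, mul_comm (coeffDenom _ _ _ _ _ _)]
  ring

/-- The constant matrix is a Cauchy matrix in the nodes r_i between two diagonal factors. A zero
diagonal entry or two equal nodes would make it singular. -/
lemma nondegenerate (hpp : ∀ i j, p i + conj (p j) ≠ 0)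
    (hdet : (of fun i j => coeff c₁ c₂ ρ₁ α p D i j / (p i + conj (p j))).det ≠ 0) :
    (∀ i, (c₂ : ℂ) * conj (D i) ≠ 0) ∧ (∀ i, D i ≠ 0) ∧
      Function.Injective fun i => cauchyNode c₁ ρ₁ α (p i) := by
  have h : (of fun i j => coeff c₁ c₂ ρ₁ α p D i j / (p i + conj (p j)))
      = of fun i j => c₂ * conj (D i) * (of fun i j =>
        1 / (cauchyNode c₁ ρ₁ α (p i) + conj (cauchyNode c₁ ρ₁ α (p j)))) i j * D j := by
    ext i j
    exact coeff_div_eq hpp i j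
  rw [h, det_scale, mul_ne_zero_iff, mul_ne_zero_iff, Finset.prod_ne_zero_iff,
    Finset.prod_ne_zero_iff] at hdet
  refine ⟨fun i => hdet.1.1 i (Finset.mem_univ i), fun i => hdet.1.2 i (Finset.mem_univ i),
    fun i j hij => ?_⟩
  by_contra hne
  refine hdet.2 (det_zero_of_row_eq hne ?_)
  ext k
  simp only [of_apply]
  rw [show cauchyNode c₁ ρ₁ α (p i) = cauchyNode c₁ ρ₁ α (p j) from hij]

variable (S : Fin N → Prop) [DecidablePred S]

/-- The limit of the rescaled matrix `M₀`, where `S` marks the exponentials that blow up. -/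
noncomputable def limitMatrix (c₁ c₂ ρ₁ α : ℝ) (p D : Fin N → ℂ) : Matrix (Fin N) (Fin N) ℂ :=
  of fun i j => ((if S i then 1 else 0) * (if S j then 1 else 0)
    + (if S i then 0 else 1) * (if S j then 0 else 1) * coeff c₁ c₂ ρ₁ α p D i j)
      / (p i + conj (p j))

/-- The block on S is a Cauchy matrix in the p_i, which are distinct because the r_i are. The other
block is a rescaled Cauchy matrix in the r_i. -/
lemma det_limitMatrix_ne_zero (hpp : ∀ i j, p i + conj (p j) ≠ 0)
    (hc : ∀ i j, coeffDenom c₁ ρ₁ α p i j ≠ 0)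
    (hdet : (of fun i j => coeff c₁ c₂ ρ₁ α p D i j / (p i + conj (p j))).det ≠ 0) :
    (limitMatrix S c₁ c₂ ρ₁ α p D).det ≠ 0 := by
  obtain ⟨hcD, hD, hr⟩ := nondegenerate hpp hdet
  have hpinj : Function.Injective p := fun i j hij => hr (by simp [hij])
  rw [twoBlockTriangular_det _ S]
  · refine mul_ne_zero ?_ ?_
    · have h : (limitMatrix S c₁ c₂ ρ₁ α p D).toSquareBlockProp S
          = of fun i j : {i // S i} => 1 / (p i + conj (p j)) := by
        ext ⟨i, hi⟩ ⟨j, hj⟩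
        simp [limitMatrix, toSquareBlockProp, toBlock, hi, hj]
      rw [h]
      exact det_cauchy_ne_zero (hpinj.comp Subtype.val_injective)
        (b := fun j : {i // S i} => conj (p j))
        (fun i j hij => Subtype.val_injective (hpinj ((starRingEnd ℂ).injective hij)))
        fun i j => hpp i j
    · have h : (limitMatrix S c₁ c₂ ρ₁ α p D).toSquareBlockProp (fun i => ¬ S i)
          = of fun i j : {i // ¬ S i} => c₂ * conj (D i) * (of fun i j : {i // ¬ S i} =>
            1 / (cauchyNode c₁ ρ₁ α (p i) + conj (cauchyNode c₁ ρ₁ α (p j)))) i j * D j := by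
        ext ⟨i, hi⟩ ⟨j, hj⟩
        have := coeff_div_eq (c₁ := c₁) (c₂ := c₂) (ρ₁ := ρ₁) (α := α) (D := D) hpp i j
        simpa [limitMatrix, toSquareBlockProp, toBlock, hi, hj] using this
      rw [h, det_scale]
      refine mul_ne_zero (mul_ne_zero (Finset.prod_ne_zero_iff.2 fun i _ => hcD i)
        (Finset.prod_ne_zero_iff.2 fun i _ => hD i)) ?_
      refine det_cauchy_ne_zero (a := fun i : {i // ¬ S i} => cauchyNode c₁ ρ₁ α (p i))
        (b := fun i : {i // ¬ S i} => conj (cauchyNode c₁ ρ₁ α (p i)))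
        (hr.comp Subtype.val_injective)
        (fun i j hij => Subtype.val_injective (hr ((starRingEnd ℂ).injective hij))) fun i j => ?_
      rw [cauchyNode_add hpp]
      exact mul_ne_zero (hpp _ _) (hc _ _)
  · intro i hi j hj
    simp [limitMatrix, hi, hj]

lemma det_bordered_limitMatrix :
    (fromBlocks (limitMatrix S c₁ c₂ ρ₁ α p D)
      (replicateCol Unit fun i => if S i then 1 else 0)
      (-replicateRow Unit fun i => if S i then 0 else D i) 0).det = 0 := by
  classical
  -- The border index joins the complement of S; in that diagonal block the border column is zero.
  rw [twoBlockTriangular_det _ (Sum.elim S fun _ => False)]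
  · refine mul_eq_zero_of_right _ (det_eq_zero_of_column_eq_zero ⟨Sum.inr (), by simp⟩ ?_)
    rintro ⟨i | i, hi⟩
    · simp only [Sum.elim_inl] at hi
      simp [toSquareBlockProp, toBlock, hi]
    · simp [toSquareBlockProp, toBlock]
  · rintro (i | i) hi (j | j) hj
    · simp only [Sum.elim_inl] at hi hj
      simp [limitMatrix, hi, hj]
    · simp at hj
    · simp only [Sum.elim_inl] at hj
      simp [hj]
    · simp at hj

lemma norm_phase (a : ℝ) (z : ℂ) (h : conj z + Complex.I * a ≠ 0) :
    ‖-(z - Complex.I * a)‖ * ‖1 / (conj z + Complex.I * a)‖ = 1 := by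
  have h1 : conj (conj z + Complex.I * a) = z - Complex.I * a := by
    simp [sub_eq_add_neg]
  rw [norm_neg, ← h1, Complex.norm_conj, norm_div, norm_one,
    mul_one_div_cancel (norm_ne_zero_iff.2 h)]

lemma boundary_of_tendsto (hρ : 0 < ρ₁) (hpp : ∀ i j, p i + conj (p j) ≠ 0)
    (hc : ∀ i j, coeffDenom c₁ ρ₁ α p i j ≠ 0)
    (hdet : (of fun i j => coeff c₁ c₂ ρ₁ α p D i j / (p i + conj (p j))).det ≠ 0)
    {l : Filter ℝ} {t : ℝ}
    (hS : ∀ i, S i → Tendsto (fun x => (xi c₁ ρ₁ p ξ₀ x t i).re) l atTop)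
    (hS' : ∀ i, ¬ S i → Tendsto (fun x => (xi c₁ ρ₁ p ξ₀ x t i).re) l atBot) :
    (∀ᶠ x in l, f c₁ c₂ ρ₁ α p ξ₀ D x t ≠ 0) ∧
      Tendsto (fun x => ‖u c₁ c₂ ρ₁ α p ξ₀ D x t‖) l (𝓝 ρ₁) ∧
      Tendsto (fun x => (g₂ c₁ c₂ ρ₁ α p ξ₀ D x t / f c₁ c₂ ρ₁ α p ξ₀ D x t).re) l (𝓝 0) := by
  set L := limitMatrix S c₁ c₂ ρ₁ α p D with hL
  have hL0 : L.det ≠ 0 := det_limitMatrix_ne_zero S hpp hc hdet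
  -- Row i is scaled by g_i and column j by the conjugate of g_j, which removes the growing
  -- exponentials. These factors drop out of all quotients of determinants.
  set g : ℝ → Fin N → ℂ := fun x i => if S i then Complex.exp (-xi c₁ ρ₁ p ξ₀ x t i) else 1
  set e : ℝ → Fin N → ℂ := fun x i => if S i then 1 else Complex.exp (xi c₁ ρ₁ p ξ₀ x t i)
  have hg0 : ∀ x i, g x i ≠ 0 := by
    intro x i
    by_cases h : S i <;> simp [g, h, Complex.exp_ne_zero]
  have hge : ∀ x i, g x i * expXi c₁ ρ₁ p ξ₀ x t i = e x i := by
    intro x i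
    by_cases h : S i
    · simp [g, e, h, expXi, ← Complex.exp_add]
    · simp [g, e, h, expXi]
  have hg : ∀ i, Tendsto (fun x => g x i) l (𝓝 (if S i then 0 else 1)) := by
    intro i
    by_cases h : S i
    · simp only [g, h, if_true]
      exact Complex.tendsto_exp_nhds_zero_iff.2
        (by simpa using hS i h)
    · simp only [g, h, if_false]
      exact tendsto_const_nhds
  have he : ∀ i, Tendsto (fun x => e x i) l (𝓝 (if S i then 1 else 0)) := by
    intro i
    by_cases h : S i
    · simp only [e, h, if_true]
      exact tendsto_const_nhds
    · simp only [e, h, if_false]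
      exact Complex.tendsto_exp_nhds_zero_iff.2 (hS' i h)
  have hconj : ∀ {w : ℝ → ℂ} {z : ℂ}, Tendsto w l (𝓝 z) →
      Tendsto (fun x => conj (w x)) l (𝓝 (conj z)) :=
    fun h => (Complex.continuous_conj.tendsto _).comp h
  -- the rescaled determinants
  set pre : ℝ → ℂ := fun x => (∏ i, g x i) * ∏ i, conj (g x i)
  have hpre : ∀ x, pre x ≠ 0 := fun x => mul_ne_zero
    (Finset.prod_ne_zero_iff.2 fun i _ => hg0 x i)
    (Finset.prod_ne_zero_iff.2 fun i _ => (map_ne_zero _).2 (hg0 x i))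
  have entry : ∀ x i j, g x i * (expXi c₁ ρ₁ p ξ₀ x t i * expXiConj c₁ ρ₁ p ξ₀ x t j) *
      conj (g x j) = e x i * conj (e x j) := by
    intro x i j
    rw [← hge, ← hge, map_mul, conj_expXi]
    ring
  have limM : ∀ i j, Tendsto (fun x => g x i * M c₁ c₂ ρ₁ α p ξ₀ D 0 x t i j * conj (g x j)) l
      (𝓝 (L i j)) := by
    intro i j
    have h1 : Tendsto (fun x => (e x i * conj (e x j) +
        g x i * conj (g x j) * coeff c₁ c₂ ρ₁ α p D i j) / (p i + conj (p j))) l (𝓝 (L i j)) := by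
      have := (((he i).mul (hconj (he j))).add
        (((hg i).mul (hconj (hg j))).mul_const (coeff c₁ c₂ ρ₁ α p D i j))).div_const
        (p i + conj (p j))
      simpa [hL, limitMatrix, apply_ite (starRingEnd ℂ)] using this
    refine h1.congr fun x => ?_
    rw [M_zero_apply, ← entry]
    ring
  have limf : Tendsto (fun x => pre x * f c₁ c₂ ρ₁ α p ξ₀ D x t) l (𝓝 L.det) := by
    simp only [f, pre, ← det_scale]
    exact tendsto_det limM
  -- In the limit the phase -(p_i - iα)/(p_j* + iα) only affects the block on S, where it splits
  -- into the row factor a_i and the column factor b_j. The product a_i b_i has modulus 1 by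
  -- `norm_phase`.
  set a : Fin N → ℂ := fun i => if S i then -(p i - Complex.I * α) else 1 with ha
  set b : Fin N → ℂ := fun i => if S i then 1 / (conj (p i) + Complex.I * α) else 1 with hb
  have limh : Tendsto (fun x => pre x * h₁ c₁ c₂ ρ₁ α p ξ₀ D x t) l
      (𝓝 ((∏ i, a i) * (∏ i, b i) * L.det)) := by
    simp only [h₁, pre, ← det_scale]
    refine tendsto_det fun i j => ?_
    have h1 : Tendsto (fun x => (-((p i - Complex.I * α) / (conj (p j) + Complex.I * α)) *
        (e x i * conj (e x j)) +
        g x i * conj (g x j) * coeff c₁ c₂ ρ₁ α p D i j) / (p i + conj (p j))) l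
        (𝓝 (a i * L i j * b j)) := by
      have := ((((he i).mul (hconj (he j))).const_mul
        (-((p i - Complex.I * α) / (conj (p j) + Complex.I * α)))).add
        (((hg i).mul (hconj (hg j))).mul_const (coeff c₁ c₂ ρ₁ α p D i j))).div_const
        (p i + conj (p j))
      convert this using 2
      by_cases hi : S i <;> by_cases hj : S j <;> simp [hL, limitMatrix, ha, hb, hi, hj]
      ring
    refine h1.congr fun x => ?_
    rw [of_apply, ← entry]
    simp only [M, of_apply, pow_one, Complex.exp_add, expXi, expXiConj]
    ring
  have limg : Tendsto (fun x => pre x * g₂ c₁ c₂ ρ₁ α p ξ₀ D x t) l (𝓝 0) := by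
    rw [← det_bordered_limitMatrix S (c₁ := c₁) (c₂ := c₂) (ρ₁ := ρ₁) (α := α) (p := p) (D := D)]
    have h0 : ∀ x, (of fun i j : Fin N ⊕ Unit => Sum.elim (g x) 1 i * fromBlocks
        (M c₁ c₂ ρ₁ α p ξ₀ D 0 x t) (replicateCol Unit (expXi c₁ ρ₁ p ξ₀ x t))
        (-replicateRow Unit D) 0 i j * Sum.elim (fun i => conj (g x i)) 1 j).det
        = pre x * g₂ c₁ c₂ ρ₁ α p ξ₀ D x t := by
      intro x
      rw [det_scale]
      simp only [Fintype.prod_sum_type, Sum.elim_inl, Sum.elim_inr, Pi.one_apply,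
        Finset.prod_const_one, mul_one]
      rfl
    refine (tendsto_det ?_).congr h0
    rintro (i | i) (j | j)
    · exact limM i j
    · refine (he i).congr fun x => ?_
      simp [← hge]
    · have := ((hconj (hg j)).const_mul (D j)).neg
      simpa [apply_ite (starRingEnd ℂ), mul_comm] using this
    · simpa using (tendsto_const_nhds : Tendsto (fun _ : ℝ => (0 : ℂ)) l _)
  have hfe : ∀ᶠ x in l, f c₁ c₂ ρ₁ α p ξ₀ D x t ≠ 0 :=
    (limf.eventually_ne hL0).mono fun x hx h => hx (by rw [h, mul_zero])
  refine ⟨hfe, ?_, ?_⟩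
  · have h1 := (limh.div limf hL0).norm
    have h2 : ‖(∏ i, a i) * (∏ i, b i) * L.det / L.det‖ = 1 := by
      rw [mul_div_cancel_right₀ _ hL0, ← Finset.prod_mul_distrib, norm_prod]
      refine Finset.prod_eq_one fun i _ => ?_
      rw [norm_mul]
      by_cases h : S i
      · simp only [ha, hb, h, if_true]
        exact norm_phase α (p i) (conj_add_ne hpp α i)
      · simp [ha, hb, h]
    rw [h2] at h1
    have h3 := h1.const_mul ρ₁
    rw [mul_one] at h3
    refine h3.congr fun x => ?_
    rw [Pi.div_apply, mul_div_mul_left _ _ (hpre x), u, norm_mul, norm_mul]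
    have h4 : Complex.I * (α * x - (α ^ 3 + 6 * c₁ * α * ρ₁ ^ 2) * t)
        = ((α * x - (α ^ 3 + 6 * c₁ * α * ρ₁ ^ 2) * t : ℝ) : ℂ) * Complex.I := by
      push_cast; ring
    rw [h4, Complex.norm_exp_ofReal_mul_I, mul_one, Complex.norm_real, Real.norm_of_nonneg hρ.le]
  · have h1 := limg.div limf hL0
    rw [zero_div] at h1
    have h2 := (Complex.continuous_re.tendsto 0).comp h1
    rw [Complex.zero_re] at h2
    refine h2.congr fun x => ?_
    rw [Function.comp_apply, Pi.div_apply, mul_div_mul_left _ _ (hpre x)]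

end asymptotics
end DarkBright

theorem theorem3p4 (N : ℕ) (c₁ c₂ ρ₁ α : ℝ) (hρ : 0 < ρ₁) (p ξ₀ D : Fin N → ℂ)
    (hp : ∀ i, conj (p i.rev) = p i)
    (hξ : ∀ i, conj (ξ₀ i.rev) = ξ₀ i)
    (hD : ∀ i, conj (D i) = D i.rev)
    -- the denominators that occur in the entries of the matrices do not vanish
    (hpp : ∀ i j, p i + conj (p j) ≠ 0)
    (hc : ∀ i j, DarkBright.coeffDenom c₁ ρ₁ α p i j ≠ 0) :
    ∃ v : ℝ → ℝ → ℝ,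
      (∀ x t, (v x t : ℂ) =
        DarkBright.g₂ c₁ c₂ ρ₁ α p ξ₀ D x t / DarkBright.f c₁ c₂ ρ₁ α p ξ₀ D x t) ∧
      IsSSmKdVSolutionOn c₁ c₂ (DarkBright.u c₁ c₂ ρ₁ α p ξ₀ D) v
        {q : ℝ × ℝ | DarkBright.f c₁ c₂ ρ₁ α p ξ₀ D q.1 q.2 ≠ 0} ∧
      -- the dark-bright boundary condition, for nondegenerate parameters
      ((Matrix.of fun i j =>
          DarkBright.coeff c₁ c₂ ρ₁ α p D i j / (p i + conj (p j))).det ≠ 0 →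
        ∀ t : ℝ, ∀ l ∈ ({Filter.atTop, Filter.atBot} : Set (Filter ℝ)),
          (∀ᶠ x in l, DarkBright.f c₁ c₂ ρ₁ α p ξ₀ D x t ≠ 0) ∧
          Filter.Tendsto (fun x => ‖DarkBright.u c₁ c₂ ρ₁ α p ξ₀ D x t‖) l (𝓝 ρ₁) ∧
          Filter.Tendsto (fun x => v x t) l (𝓝 0)) := by
  -- Where f = 0 the quotient is 0 by convention, so it equals its real part at every point.
  refine ⟨fun x t => (DarkBright.g₂ c₁ c₂ ρ₁ α p ξ₀ D x t / DarkBright.f c₁ c₂ ρ₁ α p ξ₀ D x t).re,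
    DarkBright.g₂_div_f_re hp hξ hD, DarkBright.isSSmKdVSolutionOn hp hξ hD hpp hc,
    fun hdet t l hl => ?_⟩
  have hre : ∀ i, (p i).re ≠ 0 := by
    intro i h
    apply hpp i i
    rw [Complex.add_conj, h]
    simp
  -- For fixed t, Re ξ_i is affine in x with nonzero slope Re p_i. The growing exponentials are
  -- those with Re p_i > 0 at +∞ and those with Re p_i < 0 at -∞.
  obtain ⟨k, hxi⟩ : ∃ k : Fin N → ℝ, ∀ x i, (DarkBright.xi c₁ ρ₁ p ξ₀ x t i).re
      = (p i).re * x + k i := by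
    refine ⟨fun i => (DarkBright.xi c₁ ρ₁ p ξ₀ 0 t i).re, fun x i => ?_⟩
    have : DarkBright.xi c₁ ρ₁ p ξ₀ x t i = p i * x + DarkBright.xi c₁ ρ₁ p ξ₀ 0 t i := by
      simp only [DarkBright.xi, Complex.ofReal_zero]
      ring
    rw [this, Complex.add_re, Complex.re_mul_ofReal]
  rcases hl with rfl | rfl
  · refine DarkBright.boundary_of_tendsto (fun i => 0 < (p i).re) hρ hpp hc hdet
      (fun i hi => ?_) (fun i hi => ?_) <;> simp only [hxi]
    · exact Filter.tendsto_atTop_add_const_right _ _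
        (Filter.tendsto_id.const_mul_atTop hi)
    · exact Filter.tendsto_atBot_add_const_right _ _
        (Filter.tendsto_id.const_mul_atTop_of_neg (lt_of_le_of_ne (not_lt.1 hi) (hre i)))
  · refine DarkBright.boundary_of_tendsto (fun i => (p i).re < 0) hρ hpp hc hdet
      (fun i hi => ?_) (fun i hi => ?_) <;> simp only [hxi]
    · exact Filter.tendsto_atTop_add_const_right _ _
        (Filter.tendsto_id.const_mul_atBot_of_neg hi)
    · exact Filter.tendsto_atBot_add_const_right _ _
        (Filter.tendsto_id.const_mul_atBot (lt_of_le_of_ne (not_lt.1 hi) (hre i).symm))
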